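/- Let $n\ge 1$, let $\kappa\in\mathbb C$ and let $b_1,b_2,a\in\mathrm{Mat}_n(\mathbb C)$. Consider the matrix equation $$y''=\kappa[y,y']+2y^3+zy+b_1y+yb_2+a,\qquad y=y(z)\in\mathrm{Mat}_n,\qquad (1)$$ where $[y,y']=yy'-y'y$. For $z_0\in\mathbb C$ consider the formal solutions of (1) with a pole at $z_0$, $$y=\frac{p}{z-z_0}+c_0+c_1(z-z_0)+c_2(z-z_0)^2+\cdots,\qquad p,c_j\in\mathrm{Mat}_n(\mathbb C),\quad p\neq 0 .$$ We say that (1) passes the matrix Painlevé–Kovalevskaya test if, for every $z_0\in\mathbb C$, the coefficients of these solutions contain $2n^2-1$ arbitrary constants (in addition to $z_0$), that is, some $2n^2-1$ of the scalar entries of $p,c_0,c_1,\dots$ are algebraically independent over $\mathbb C$ as functions on the set of all such solutions: no nonzero complex polynomial in these entries vanishes on all of them. Theorem. Equation (1) passes the matrix Painlevé–Kovalevskaya test if and only if there are $\beta_1,\beta_2\in\mathbb C$ such that the transformation $b_1\to b_1+\beta_1I$, $b_2\to b_2+\beta_2I$, $z\to z-\beta_1-\beta_2$ reduces it to one of the following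 equations: - $\mathrm P_2^0$: $\;y''=2y^3+zy+by+yb+\alpha I$ with $\alpha\in\mathbb C$, $b\in\mathrm{Mat}_n(\mathbb C)$; - $\mathrm P_2^1$: $\;y''=\pm[y,y']+2y^3+zy+a$ with $a\in\mathrm{Mat}_n(\mathbb C)$; - $\mathrm P_2^2$: $\;y''=\pm2[y,y']+2y^3+zy+by+yb+a$ with $a,b\in\mathrm{Mat}_n(\mathbb C)$, $[b,a]=\pm2b$ (the same sign in both places). Here an equation $y''=F(z,y,y')$ is identified with its right-hand side $F$ as a function of $z\in\mathbb C$ and $y,y'\in\mathrm{Mat}_n(\mathbb C)$. Thus for $n\ge2$ the value of $\kappa$ is determined by the equation, while for $n=1$ the commutator term is absent. -/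

import Mathlib

namespace MatrixPainleveTwo

/-- Complex `n × n` matrices. -/
abbrev Mat (n : ℕ) : Type := Matrix (Fin n) (Fin n) ℂ

/-- The right-hand side `κ [y, y'] + 2 y³ + z y + b₁ y + y b₂ + a` (with `w` in the place of `y'`),
in any associative `ℂ`-algebra. It is used for matrices and for Laurent series of matrices. -/
def rhs {A : Type*} [Ring A] [Algebra ℂ A] (κ : ℂ) (b₁ b₂ a : A) (z y w : A) : A :=
  κ • (y * w - w * y) + (2 : ℂ) • y ^ 3 + z * y + b₁ * y + y * b₂ + a

/-- `y = p / (z - z₀) + c₀ + c₁ (z - z₀) + ⋯` with `p ≠ 0` is a formal solution of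
`y'' = κ [y, y'] + 2 y³ + z y + b₁ y + y b₂ + a`. Series are Laurent series in the variable
`X = z - z₀` with matrix coefficients, so that `z = z₀ + X`; the coefficient of `X ^ (-1)` is `p`
and that of `X ^ j` is `c_j`. -/
structure IsPolarSolution {n : ℕ} (κ : ℂ) (b₁ b₂ a : Mat n) (z₀ : ℂ)
    (y : LaurentSeries (Mat n)) : Prop where
  coeff_eq_zero : ∀ k : ℤ, k < -1 → y.coeff k = 0
  residue_ne_zero : y.coeff (-1) ≠ 0
  equation :
    LaurentSeries.derivative ℂ (LaurentSeries.derivative ℂ y) =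
      rhs κ (HahnSeries.C b₁) (HahnSeries.C b₂) (HahnSeries.C a)
        (HahnSeries.C (z₀ • (1 : Mat n)) + HahnSeries.single 1 (1 : Mat n))
        y (LaurentSeries.derivative ℂ y)

/-- The formal solutions with a pole at `z₀`. -/
abbrev PolarSolution {n : ℕ} (κ : ℂ) (b₁ b₂ a : Mat n) (z₀ : ℂ) : Type :=
  {y : LaurentSeries (Mat n) // IsPolarSolution κ b₁ b₂ a z₀ y}

/-- The entry `(r, s)` of the coefficient of `X ^ j`, as a function of the solution; the index is
`e = (j, r, s)`. -/
def coeffEntry {n : ℕ} (κ : ℂ) (b₁ b₂ a : Mat n) (z₀ : ℂ) (e : ℤ × Fin n × Fin n) :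
    PolarSolution κ b₁ b₂ a z₀ → ℂ :=
  fun y => (y.1.coeff e.1) e.2.1 e.2.2

/-- The coefficients of the formal solutions with a pole at `z₀` contain `N` arbitrary constants:
some `N` of the scalar entries of the coefficients satisfy no polynomial relation, that is, every
nonzero complex polynomial in `N` variables is nonzero on these entries of some solution. -/
def ContainsConstants {n : ℕ} (κ : ℂ) (b₁ b₂ a : Mat n) (z₀ : ℂ) (N : ℕ) : Prop :=
  ∃ e : Fin N → ℤ × Fin n × Fin n,
    AlgebraicIndependent ℂ (fun i : Fin N => coeffEntry κ b₁ b₂ a z₀ (e i))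

/-- The matrix Painlevé–Kovalevskaya test: the point `z₀` is arbitrary, and the coefficients
contain `2 n² - 1` further arbitrary constants (for `1 ≤ n` the subtraction is the usual one). -/
def PassesTest {n : ℕ} (κ : ℂ) (b₁ b₂ a : Mat n) : Prop :=
  ∀ z₀ : ℂ, ContainsConstants κ b₁ b₂ a z₀ (2 * n ^ 2 - 1)

/-- The equation `y'' = F(z, y, y')` is
`y'' = 2 y³ + z y + b y + y b + α I` with a scalar `α` and a matrix `b`. -/
def IsP20 {n : ℕ} (F : ℂ → Mat n → Mat n → Mat n) : Prop :=
  ∃ (α : ℂ) (b : Mat n), ∀ (z : ℂ) (y w : Mat n),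
    F z y w = (2 : ℂ) • y ^ 3 + z • y + b * y + y * b + α • (1 : Mat n)

/-- The equation `y'' = F(z, y, y')` is
`y'' = ± [y, y'] + 2 y³ + z y + a` with a matrix `a`. -/
def IsP21 {n : ℕ} (F : ℂ → Mat n → Mat n → Mat n) : Prop :=
  ∃ (ε : ℂ) (a : Mat n), (ε = 1 ∨ ε = -1) ∧ ∀ (z : ℂ) (y w : Mat n),
    F z y w = ε • (y * w - w * y) + (2 : ℂ) • y ^ 3 + z • y + a

/-- The equation `y'' = F(z, y, y')` is
`y'' = ± 2 [y, y'] + 2 y³ + z y + b y + y b + a` with matrices `a`, `b` such that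
`[b, a] = ± 2 b`, with the same sign. -/
def IsP22 {n : ℕ} (F : ℂ → Mat n → Mat n → Mat n) : Prop :=
  ∃ (ε : ℂ) (a b : Mat n), (ε = 1 ∨ ε = -1) ∧ b * a - a * b = (ε * 2) • b ∧
    ∀ (z : ℂ) (y w : Mat n),
      F z y w = (ε * 2) • (y * w - w * y) + (2 : ℂ) • y ^ 3 + z • y + b * y + y * b + a

/-- The right-hand side after `b₁ → b₁ + β₁ I`, `b₂ → b₂ + β₂ I`, `z → z - β₁ - β₂`. In terms of
the new independent variable `z`, the old one is `z + β₁ + β₂`, and it occurs only in `z y`, so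
the equation for `y` as a function of the new variable has the right-hand side below. -/
def shiftedRhs {n : ℕ} (κ : ℂ) (b₁ b₂ a : Mat n) (β₁ β₂ : ℂ) : ℂ → Mat n → Mat n → Mat n :=
  fun z y w =>
    rhs κ (b₁ + β₁ • (1 : Mat n)) (b₂ + β₂ • (1 : Mat n)) a (z • (1 : Mat n)) y w

end MatrixPainleveTwo

/-! Write y = ∑ f k X^(k-1) with X = z - z₀; the constant z₀ is absorbed into b₁. The equation
becomes a triangular system: p = f 0 satisfies p³ = p, and for k ≥ 1 the k-th equation is `resOp κ p
k (f k)` = an expression in earlier coefficients. The matrix p is diagonalizable with eigenvalues in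
{0, 1, -1}, and on the block of eigenvalues l, m the operator is the scalar `resEig κ k l m`, a
monic quadratic in k. Constants can enter only at its natural roots, the resonances; k = 0 counts
the deformations of p.

Each of the n² pairs of eigenvectors has at most two resonances, and a pair (l, l) with l = ±1 has
only k = 4, the other root being -1. So there are at most 2n² - 1 constants. For n ≥ 2, equality
forces a single nonzero eigenvalue, with resonances 0 and 3 ± κ between it and the kernel, the
latter being positive integers. Hence κ ∈ {0, ±1, ±2}. The symmetries y ↦ -y and transposition
reduce to p² = p and κ ∈ {0, 1, 2}.

At a positive resonance the right-hand side must vanish on the block concerned. The conditions that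
restrict the equation arise at k = 3 for κ = 0, at k = 2 and 4 for κ = 1, at k = 4 and 5 for κ = 2.

Necessity: the test yields one solution over a field K whose chosen coefficients are algebraically
independent. Derivations of K then realize every variation allowed by the resonances
(`IsFullSolution.of_algebraicIndependent`). Differentiating the compatibility conditions along them
strips off the free coefficients and leaves p d (1 - p) = 0, or the opposite block, for a constant
matrix d. Since p is generic, d is scalar (`IsFullSolution.exists_eq_smul_one`).

Sufficiency: for the normal forms all obstructions vanish identically, so the recursion can be
solved over a polynomial ring in 2n² - 1 variables, after conjugating the residue to a diagonal
unit. The variables are algebraic over the algebra generated by the coefficients, so some 2n² - 1 of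
the entries are algebraically independent. -/

namespace MatrixPainleveTwo

open Finset

/-! ### The equation as a system for the coefficient sequence -/

section Sequences

variable {A : Type*} [Ring A] [Algebra ℂ A]

/-- The Cauchy product of two sequences. -/
def conv (f g : ℕ → A) (k : ℕ) : A := ∑ x ∈ antidiagonal k, f x.1 * g x.2

/-- The coefficients of `X ^ 2 * y'` for `y = ∑ f k * X ^ (k - 1)`. -/
def theta (f : ℕ → A) (k : ℕ) : A := ((k : ℂ) - 1) • f k

/-- The coefficient of `X ^ (k - 3)` in
`y'' - (κ [y, y'] + 2 y³ + X y + b y + y c + a)` for `y = ∑ f k * X ^ (k - 1)`. -/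
def defect (κ : ℂ) (b c a : A) (f : ℕ → A) (k : ℕ) : A :=
  (((k : ℂ) - 1) * ((k : ℂ) - 2)) • f k - κ • (conv f (theta f) k - conv (theta f) f k)
    - (2 : ℂ) • conv (conv f f) f k
    - (if 2 ≤ k then b * f (k - 2) + f (k - 2) * c else 0)
    - (if 3 ≤ k then f (k - 3) else 0) - (if k = 3 then a else 0)

end Sequences

/-! ### Translation between Laurent series and sequences -/

section Laurent

variable {A : Type*} [Ring A]

open HahnSeries

theorem single_one_mul_comm (m : ℤ) (x : LaurentSeries A) :
    single m (1 : A) * x = x * single m 1 := by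
  ext k
  have h := coeff_single_mul_add (r := (1 : A)) (x := x) (a := k - m) (b := m)
  have h' := coeff_mul_single_add (r := (1 : A)) (x := x) (a := k - m) (b := m)
  simp only [sub_add_cancel] at h h'
  simp [h, h']

theorem coeff_single_one_mul (m k : ℤ) (x : LaurentSeries A) :
    (single m (1 : A) * x).coeff k = x.coeff (k - m) := by
  have h := coeff_single_mul_add (r := (1 : A)) (x := x) (a := k - m) (b := m)
  simpa using h

/-- The Laurent series `X ^ m * ∑ f k * X ^ k`. -/
noncomputable def shifted (m : ℤ) (f : ℕ → A) : LaurentSeries A :=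
  single m (1 : A) * ofPowerSeries ℤ A (PowerSeries.mk f)

theorem coeff_shifted (m : ℤ) (f : ℕ → A) (k : ℕ) : (shifted m f).coeff (m + k) = f k := by
  rw [shifted, coeff_single_one_mul]
  simp

theorem coeff_shifted_of_lt (m : ℤ) (f : ℕ → A) {k : ℤ} (hk : k < m) :
    (shifted m f).coeff k = 0 := by
  rw [shifted, coeff_single_one_mul, ofPowerSeries_apply,
    embDomain_of_notMem_range]
  simpa using hk

theorem eq_shifted {m : ℤ} {y : LaurentSeries A} (hy : ∀ k < m, y.coeff k = 0) :
    y = shifted m (fun k => y.coeff (m + k)) := by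
  ext k
  rcases lt_or_ge k m with h | h
  · rw [hy k h, coeff_shifted_of_lt _ _ h]
  · obtain ⟨l, rfl⟩ := Int.le.dest h
    rw [coeff_shifted]

theorem shifted_mul (m l : ℤ) (f g : ℕ → A) :
    shifted m f * shifted l g = shifted (m + l) (conv f g) := by
  have h : PowerSeries.mk (conv f g) = PowerSeries.mk f * PowerSeries.mk g := by
    ext k; simp [PowerSeries.coeff_mul, conv]
  rw [shifted, shifted, shifted, h, map_mul, mul_assoc, ← mul_assoc (ofPowerSeries _ _ _),
    ← single_one_mul_comm, ← mul_assoc, ← mul_assoc, single_mul_single, one_mul, ← mul_assoc]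

variable [Algebra ℂ A]

theorem derivative_shifted (m : ℤ) (f : ℕ → A) :
    LaurentSeries.derivative ℂ (shifted m f) =
      shifted (m - 1) (fun k => ((m : ℂ) + k) • f k) := by
  ext k
  rw [LaurentSeries.derivative_apply, LaurentSeries.hasseDeriv_coeff]
  rcases lt_or_ge k (m - 1) with h | h
  · rw [coeff_shifted_of_lt _ _ h, coeff_shifted_of_lt _ _ (by push_cast; omega), smul_zero]
  · obtain ⟨l, rfl⟩ := Int.le.dest h
    rw [coeff_shifted, show m - 1 + (l : ℤ) + ((1 : ℕ) : ℤ) = m + l by push_cast; ring,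
      coeff_shifted, Ring.choose_one_right, ← Int.cast_smul_eq_zsmul ℂ]
    push_cast
    rfl

theorem equation_iff (κ z₀ : ℂ) (b c a : A) (f : ℕ → A) :
    LaurentSeries.derivative ℂ (LaurentSeries.derivative ℂ (shifted (-1) f)) =
      rhs κ (C b) (C c) (C a) (C (z₀ • (1 : A)) + single 1 (1 : A))
        (shifted (-1) f) (LaurentSeries.derivative ℂ (shifted (-1) f)) ↔
    ∀ k, defect κ (b + z₀ • (1 : A)) c a f k = 0 := by
  have e1 : LaurentSeries.derivative ℂ (shifted (-1) f) = shifted (-2) (theta f) := by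
    rw [derivative_shifted]
    congr 1
    funext k
    simp only [theta]; congr 1; push_cast; ring
  have e2 : LaurentSeries.derivative ℂ (shifted (-2) (theta f)) =
      shifted (-3) (fun k => (((k : ℂ) - 1) * ((k : ℂ) - 2)) • f k) := by
    rw [derivative_shifted]
    congr 1
    funext k
    simp only [theta, smul_smul]; congr 1; push_cast; ring
  have e3 : shifted (-1) f ^ 3 = shifted (-3) (conv (conv f f) f) := by
    rw [pow_succ, pow_two, shifted_mul, shifted_mul]; norm_num
  rw [e1, e2, rhs, e3, shifted_mul, shifted_mul]
  -- z y = z₀ y + X y, and z₀ y joins b y; hence `b + z₀ • 1` in the defect.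
  have key : ∀ k : ℕ,
      (κ • (shifted (-1 + -2) (conv f (theta f)) - shifted (-2 + -1) (conv (theta f) f)) +
        (2 : ℂ) • shifted (-3) (conv (conv f f) f) +
        (C (z₀ • (1 : A)) + single 1 (1 : A)) * shifted (-1) f +
        C b * shifted (-1) f + shifted (-1) f * C c + C a : LaurentSeries A).coeff (-3 + k) =
      (((k : ℂ) - 1) * ((k : ℂ) - 2)) • f k - defect κ (b + z₀ • (1 : A)) c a f k := by
    intro k
    have h2 : (shifted (-1) f).coeff (-3 + k) = if 2 ≤ k then f (k - 2) else 0 := by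
      split_ifs with h
      · rw [show (-3 + k : ℤ) = -1 + (k - 2 : ℕ) by omega, coeff_shifted]
      · rw [coeff_shifted_of_lt]; omega
    have h3 : (shifted (-1) f).coeff (-3 + k - 1) = if 3 ≤ k then f (k - 3) else 0 := by
      split_ifs with h
      · rw [show (-3 + k - 1 : ℤ) = -1 + (k - 3 : ℕ) by omega, coeff_shifted]
      · rw [coeff_shifted_of_lt]; omega
    have h4 : (C a : LaurentSeries A).coeff (-3 + k) = if k = 3 then a else 0 := by
      rw [C_apply, coeff_single]
      congr 1
      simp only [eq_iff_iff]; omega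
    rw [add_mul, coeff_add, coeff_add, coeff_add, coeff_add, coeff_add, coeff_add, coeff_smul,
      coeff_sub, coeff_smul, coeff_single_one_mul, C_apply, coeff_single_zero_mul,
      C_apply, coeff_single_zero_mul, C_apply, coeff_mul_single_zero, h2, h3, h4]
    norm_num only
    rw [coeff_shifted, coeff_shifted, coeff_shifted, defect]
    split_ifs <;> simp [add_mul] <;> abel
  constructor
  · intro h k
    have := congrArg (fun y => y.coeff (-3 + k)) h
    simp only [key, coeff_shifted] at this
    exact sub_eq_self.1 this.symm
  · intro h
    ext k
    rcases lt_or_ge k (-3) with hk | hk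
    · rw [coeff_shifted_of_lt _ _ hk]
      rw [add_mul, coeff_add, coeff_add, coeff_add, coeff_add, coeff_add, coeff_add, coeff_smul,
        coeff_sub, coeff_smul, coeff_single_one_mul, C_apply, coeff_single_zero_mul,
        C_apply, coeff_single_zero_mul, C_apply, coeff_mul_single_zero, C_apply, coeff_single]
      rw [if_neg (by omega)]
      simp (disch := omega) [coeff_shifted_of_lt]
    · obtain ⟨l, rfl⟩ := Int.le.dest hk
      rw [key, h, coeff_shifted, sub_zero]

end Laurent

theorem isPolarSolution_shifted {n : ℕ} {κ z₀ : ℂ} {b₁ b₂ a : Mat n} {f : ℕ → Mat n} :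
    IsPolarSolution κ b₁ b₂ a z₀ (shifted (-1) f) ↔
      f 0 ≠ 0 ∧ ∀ k, defect κ (b₁ + z₀ • (1 : Mat n)) b₂ a f k = 0 := by
  have h0 := coeff_shifted (-1) f 0
  simp only [Nat.cast_zero, add_zero] at h0
  constructor
  · rintro ⟨-, h1, h2⟩
    exact ⟨h0 ▸ h1, (equation_iff κ z₀ b₁ b₂ a f).1 h2⟩
  · rintro ⟨h1, h2⟩
    exact ⟨fun k hk => coeff_shifted_of_lt _ _ hk, h0.symm ▸ h1,
      (equation_iff κ z₀ b₁ b₂ a f).2 h2⟩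

theorem IsPolarSolution.defect_eq_zero {n : ℕ} {κ z₀ : ℂ} {b₁ b₂ a : Mat n}
    {y : LaurentSeries (Mat n)} (hy : IsPolarSolution κ b₁ b₂ a z₀ y) (k : ℕ) :
    defect κ (b₁ + z₀ • (1 : Mat n)) b₂ a (fun k => y.coeff (-1 + k)) k = 0 := by
  have h := eq_shifted hy.coeff_eq_zero
  rw [h] at hy
  exact (isPolarSolution_shifted.1 hy).2 k

/-! ### Triangular structure and the first five equations -/

section Triangular

variable {A : Type*} [Ring A]

/-- In the k-th Cauchy coefficient only the terms with indices (k, 0) and (0, k) involve a k-th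
coefficient, and for k ≥ 1 these are different terms. -/
theorem conv_sub_conv {f f' g g' : ℕ → A} {k : ℕ} (hk : 1 ≤ k) (hf : ∀ i < k, f i = f' i)
    (hg : ∀ i < k, g i = g' i) :
    conv f g k - conv f' g' k = (f k - f' k) * g' 0 + f' 0 * (g k - g' k) := by
  rw [conv, conv, ← sum_sub_distrib,
    ← sum_subset (s₁ := {(k, 0), (0, k)}) (fun x hx => ?_) (fun x hx hx' => ?_),
    sum_pair (by simp; omega)]
  · simp only [hf 0 (by omega), hg 0 (by omega)]
    noncomm_ring
  · simp only [mem_insert, mem_singleton] at hx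
    rcases hx with rfl | rfl <;> simp
  · obtain ⟨i, l⟩ := x
    simp only [HasAntidiagonal.mem_antidiagonal, mem_insert, mem_singleton, Prod.mk.injEq] at hx hx'
    simp only
    rw [hf i (by omega), hg l (by omega), sub_self]

theorem conv_congr {f f' g g' : ℕ → A} {k : ℕ} (hf : ∀ i ≤ k, f i = f' i)
    (hg : ∀ i ≤ k, g i = g' i) : conv f g k = conv f' g' k := by
  refine sum_congr rfl fun x hx => ?_
  rw [HasAntidiagonal.mem_antidiagonal] at hx
  rw [hf _ (by omega), hg _ (by omega)]

variable [Algebra ℂ A]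

/-- The linear operator acting on the coefficient of `X ^ (k - 1)` in the equation for the
coefficients of a solution with residue `p`. -/
def resOp (κ : ℂ) (p : A) (k : ℕ) (w : A) : A :=
  (((k : ℂ) - 1) * ((k : ℂ) - 2)) • w - (κ * k) • (p * w - w * p) -
    (2 : ℂ) • (p * p * w + p * w * p + w * p * p)

/-- For k ≥ 1 the k-th equation is affine in the k-th coefficient. The factor κ k arises from (k -
1)[p, w] together with [p, w], since `theta` multiplies the residue by -1. -/
theorem defect_sub_defect {κ : ℂ} {b c a : A} {f g : ℕ → A} {k : ℕ} (hk : 1 ≤ k)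
    (h : ∀ i < k, f i = g i) :
    defect κ b c a f k - defect κ b c a g k = resOp κ (g 0) k (f k - g k) := by
  have ht : ∀ i < k, theta f i = theta g i := fun i hi => by rw [theta, theta, h i hi]
  have h1 := conv_sub_conv hk h ht
  have h2 := conv_sub_conv hk ht h
  have h3 := conv_sub_conv hk (f := conv f f) (f' := conv g g)
    (fun i hi => conv_congr (fun l hl => h l (by omega)) (fun l hl => h l (by omega))) h
  rw [conv_sub_conv hk h h] at h3
  have h4 : (if 2 ≤ k then b * f (k - 2) + f (k - 2) * c else 0) =
      if 2 ≤ k then b * g (k - 2) + g (k - 2) * c else 0 := by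
    split_ifs with h'
    · rw [h _ (by omega)]
    · rfl
  have h5 : (if 3 ≤ k then f (k - 3) else 0) = if 3 ≤ k then g (k - 3) else 0 := by
    split_ifs with h'
    · rw [h _ (by omega)]
    · rfl
  have h6 : conv g g 0 = g 0 * g 0 := by simp [conv]
  rw [defect, defect, h4, h5, resOp]
  rw [sub_eq_iff_eq_add] at h1 h2 h3
  rw [h1, h2, h3, h6]
  simp only [theta, mul_sub, sub_mul, add_mul, mul_smul_comm, smul_mul_assoc,
    mul_assoc]
  push_cast
  module

/-- The leading balance p³ = p. The expansions below continue to k = 5, the largest resonance 3 + κ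
for κ ≤ 2. -/
theorem defect_zero {κ : ℂ} {b c a : A} {f : ℕ → A} :
    defect κ b c a f 0 = (2 : ℂ) • (f 0 - f 0 * f 0 * f 0) := by
  simp [defect, conv, theta]
  module

theorem defect_one {κ : ℂ} {b c a : A} {f : ℕ → A} :
    defect κ b c a f 1 = resOp κ (f 0) 1 (f 1) := by
  simp [defect, conv, theta, resOp, Nat.sum_antidiagonal_eq_sum_range_succ_mk, sum_range_succ,
    add_mul, mul_assoc]
  module

theorem defect_two {κ : ℂ} {b c a : A} {f : ℕ → A} :
    defect κ b c a f 2 = resOp κ (f 0) 2 (f 2) - ((2 : ℂ) • (f 0 * f 1 * f 1 + f 1 * f 0 * f 1 +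
      f 1 * f 1 * f 0) + b * f 0 + f 0 * c) := by
  simp [defect, conv, theta, resOp, Nat.sum_antidiagonal_eq_sum_range_succ_mk, sum_range_succ,
    add_mul, mul_assoc]
  module

theorem defect_three {κ : ℂ} {b c a : A} {f : ℕ → A} :
    defect κ b c a f 3 = resOp κ (f 0) 3 (f 3) - (κ • (f 1 * f 2 - f 2 * f 1) +
      (2 : ℂ) • (f 0 * f 1 * f 2 + f 0 * f 2 * f 1 + f 1 * f 0 * f 2 + f 2 * f 0 * f 1 +
        f 1 * f 2 * f 0 + f 2 * f 1 * f 0 + f 1 * f 1 * f 1) +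
      b * f 1 + f 1 * c + f 0 + a) := by
  simp [defect, conv, theta, resOp, Nat.sum_antidiagonal_eq_sum_range_succ_mk, sum_range_succ,
    add_mul, mul_assoc]
  module

theorem defect_four {κ : ℂ} {b c a : A} {f : ℕ → A} :
    defect κ b c a f 4 = resOp κ (f 0) 4 (f 4) - ((2 * κ) • (f 1 * f 3 - f 3 * f 1) +
      (2 : ℂ) • (f 0 * f 1 * f 3 + f 0 * f 3 * f 1 + f 1 * f 0 * f 3 + f 3 * f 0 * f 1 +
        f 1 * f 3 * f 0 + f 3 * f 1 * f 0 + f 0 * f 2 * f 2 + f 2 * f 0 * f 2 + f 2 * f 2 * f 0 +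
        f 1 * f 1 * f 2 + f 1 * f 2 * f 1 + f 2 * f 1 * f 1) +
      b * f 2 + f 2 * c + f 1) := by
  simp [defect, conv, theta, resOp, Nat.sum_antidiagonal_eq_sum_range_succ_mk, sum_range_succ,
    add_mul, mul_assoc]
  module

theorem defect_five {κ : ℂ} {b c a : A} {f : ℕ → A} :
    defect κ b c a f 5 = resOp κ (f 0) 5 (f 5) - ((3 * κ) • (f 1 * f 4 - f 4 * f 1) +
      κ • (f 2 * f 3 - f 3 * f 2) +
      (2 : ℂ) • (f 0 * f 1 * f 4 + f 0 * f 4 * f 1 + f 1 * f 0 * f 4 + f 4 * f 0 * f 1 +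
        f 1 * f 4 * f 0 + f 4 * f 1 * f 0 + f 0 * f 2 * f 3 + f 0 * f 3 * f 2 + f 2 * f 0 * f 3 +
        f 3 * f 0 * f 2 + f 2 * f 3 * f 0 + f 3 * f 2 * f 0 +
        f 1 * f 1 * f 3 + f 1 * f 3 * f 1 + f 3 * f 1 * f 1 +
        f 1 * f 2 * f 2 + f 2 * f 1 * f 2 + f 2 * f 2 * f 1) +
      b * f 3 + f 3 * c + f 2) := by
  simp [defect, conv, theta, resOp, Nat.sum_antidiagonal_eq_sum_range_succ_mk, sum_range_succ,
    add_mul, mul_assoc]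
  module

end Triangular

/-! ### Resonance operator on the blocks of an idempotent residue -/

section Peirce

variable {A : Type*} [Ring A]

theorem mul_mul_of_mul_eq {x y z : A} (h : x * y = z) (w : A) : x * (y * w) = z * w := by
  rw [← mul_assoc, h]

variable [Algebra ℂ A]

/-- The scalars on the four blocks factor as (k - 4)(k + 1), k(k - 3 - κ), k(k - 3 + κ) and (k -
1)(k - 2); this is where the resonances are read off. -/
theorem idem_resOp_idem {p : A} (hp : p * p = p) (κ : ℂ) (k : ℕ) (w : A) :
    p * resOp κ p k w * p = (((k : ℂ) - 1) * (k - 2) - 6) • (p * w * p) := by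
  simp only [resOp, mul_add, mul_sub, add_mul, sub_mul, mul_smul_comm, smul_mul_assoc, mul_assoc,
    hp, mul_mul_of_mul_eq hp]
  module

theorem idem_resOp_compl {p : A} (hp : p * p = p) (κ : ℂ) (k : ℕ) (w : A) :
    p * resOp κ p k w * (1 - p) =
      (((k : ℂ) - 1) * (k - 2) - κ * k - 2) • (p * w * (1 - p)) := by
  simp only [resOp, mul_add, mul_sub, add_mul, sub_mul, mul_smul_comm, smul_mul_assoc, mul_assoc,
    hp, mul_mul_of_mul_eq hp, mul_one]
  module

theorem compl_resOp_idem {p : A} (hp : p * p = p) (κ : ℂ) (k : ℕ) (w : A) :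
    (1 - p) * resOp κ p k w * p =
      (((k : ℂ) - 1) * (k - 2) + κ * k - 2) • ((1 - p) * w * p) := by
  simp only [resOp, mul_add, mul_sub, add_mul, sub_mul, mul_smul_comm, smul_mul_assoc, mul_assoc,
    hp, mul_mul_of_mul_eq hp, one_mul]
  module

theorem compl_resOp_compl {p : A} (hp : p * p = p) (κ : ℂ) (k : ℕ) (w : A) :
    (1 - p) * resOp κ p k w * (1 - p) =
      (((k : ℂ) - 1) * (k - 2)) • ((1 - p) * w * (1 - p)) := by
  simp only [resOp, mul_add, mul_sub, add_mul, sub_mul, mul_smul_comm, smul_mul_assoc, mul_assoc,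
    hp, mul_mul_of_mul_eq hp, mul_one, one_mul]
  module

end Peirce

/-! ### Obstructions for κ = 2 -/

section KappaTwo

variable {A : Type*} [Ring A] [Algebra ℂ A] {p b c a : A} {f : ℕ → A}

theorem kappa_two_coeff_one (hp : p * p = p) (h0 : f 0 = p) (h1 : defect 2 b c a f 1 = 0) :
    p * f 1 = 0 := by
  rw [defect_one, h0] at h1
  have e1 := idem_resOp_idem hp 2 1 (f 1)
  have e2 := idem_resOp_compl hp 2 1 (f 1)
  rw [h1] at e1 e2
  simp only [mul_sub, sub_mul, mul_one, mul_zero, zero_mul, mul_assoc, smul_sub] at e1 e2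
  push_cast at e1 e2
  -- The blocks have eigenvalues -4 and -6; here and in the similar lemmas the weights are their
  -- inverses up to sign.
  linear_combination (norm := module) (1 / 4 : ℂ) • e2 + (1 / 6 : ℂ) • e1

theorem kappa_two_coeff_two (hp : p * p = p) (h0 : f 0 = p) (h1 : defect 2 b c a f 1 = 0)
    (h2 : defect 2 b c a f 2 = 0) :
    p * f 2 = (-1 / 6 : ℂ) • (p * (b * p) + p * c) := by
  have r1 := kappa_two_coeff_one hp h0 h1
  rw [defect_two, h0, sub_eq_zero] at h2
  have e1 := idem_resOp_idem hp 2 2 (f 2)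
  have e2 := idem_resOp_compl hp 2 2 (f 2)
  rw [h2] at e1 e2
  simp only [mul_sub, sub_mul, mul_add, add_mul, mul_one, mul_zero, zero_mul, mul_assoc, smul_sub,
    hp, mul_mul_of_mul_eq hp, r1, mul_mul_of_mul_eq r1, mul_smul_comm, smul_mul_assoc] at e1 e2
  push_cast at e1 e2
  linear_combination (norm := module) (1 / 6 : ℂ) • e2 + (1 / 6 : ℂ) • e1

/-- On the lower block at k = 2 the eigenvalue is 2, so `f 2 * p` is determined; the lower block of
`f 1` is free, since 3 - κ = 1, and therefore survives in the formula. -/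
theorem kappa_two_coeff_two_mul (hp : p * p = p) (h0 : f 0 = p) (h1 : defect 2 b c a f 1 = 0)
    (h2 : defect 2 b c a f 2 = 0) :
    f 2 * p = f 1 * (f 1 * p) + (1 / 2 : ℂ) • (b * p) - (2 / 3 : ℂ) • (p * (b * p))
      - (1 / 6 : ℂ) • (p * (c * p)) := by
  have r1 := kappa_two_coeff_one hp h0 h1
  have r2 := kappa_two_coeff_two hp h0 h1 h2
  rw [defect_two, h0, sub_eq_zero] at h2
  have e1 := compl_resOp_idem hp 2 2 (f 2)
  rw [h2] at e1
  simp only [mul_sub, sub_mul, mul_add, add_mul, one_mul, mul_zero, zero_mul, mul_assoc, smul_sub,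
    hp, mul_mul_of_mul_eq hp, r1, mul_mul_of_mul_eq r1, mul_mul_of_mul_eq r2,
    mul_smul_comm, smul_mul_assoc] at e1
  push_cast at e1
  linear_combination (norm := module) (-1 / 2 : ℂ) • e1

/-- The obstruction at the fourth coefficient when `κ = 2`. -/
theorem kappa_two_idem_defect_four_idem (hp : p * p = p) (h0 : f 0 = p)
    (h1 : defect 2 b c a f 1 = 0) (h2 : defect 2 b c a f 2 = 0) :
    p * defect 2 b c a f 4 * p =
      -(p * (b - c) * (f 1 * f 1 * p)) -
      (1 / 6 : ℂ) • (p * c * p * (b - c) * p - p * (b - c) * p * c * p + p * b * (1 - p) * (b - c) * p +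
        p * (b - c) * (1 - p) * c * p + (2 : ℂ) • (p * (b - c) * (1 - p) * b * p)) := by
  have r1 := kappa_two_coeff_one hp h0 h1
  have r2 := kappa_two_coeff_two hp h0 h1 h2
  have r3 := kappa_two_coeff_two_mul hp h0 h1 h2
  have e1 := idem_resOp_idem hp 2 4 (f 4)
  rw [defect_four, h0, mul_sub, sub_mul, e1]
  simp only [mul_sub, sub_mul, mul_add, add_mul, one_mul, mul_zero, zero_mul, mul_assoc, smul_sub,
    mul_one, smul_add,
    hp, mul_mul_of_mul_eq hp, r1, mul_mul_of_mul_eq r1, r2, mul_mul_of_mul_eq r2,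
    mul_smul_comm, smul_mul_assoc, r3]
  push_cast
  module

theorem kappa_two_coeff_three (hp : p * p = p) (h0 : f 0 = p) (h1 : defect 2 b b a f 1 = 0)
    (h2 : defect 2 b b a f 2 = 0) (h3 : defect 2 b b a f 3 = 0) :
    p * f 3 = (-1 / 4 : ℂ) • p - (1 / 12 : ℂ) • (p * (a * p)) - (1 / 6 : ℂ) • (p * a)
      - (1 / 6 : ℂ) • (p * (b * f 1)) := by
  have r1 := kappa_two_coeff_one hp h0 h1
  have r2 := kappa_two_coeff_two hp h0 h1 h2
  have r3 := kappa_two_coeff_two_mul hp h0 h1 h2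
  rw [defect_three, h0, sub_eq_zero] at h3
  have e1 := idem_resOp_idem hp 2 3 (f 3)
  have e2 := idem_resOp_compl hp 2 3 (f 3)
  rw [h3] at e1 e2
  simp only [mul_sub, sub_mul, mul_add, add_mul, mul_one, mul_zero, zero_mul, mul_assoc, smul_sub,
    smul_add, hp, mul_mul_of_mul_eq hp, r1, mul_mul_of_mul_eq r1, r2, r3, mul_mul_of_mul_eq r2,
    mul_smul_comm, smul_mul_assoc] at e1 e2
  push_cast at e1 e2
  linear_combination (norm := module) (1 / 6 : ℂ) • e2 + (1 / 4 : ℂ) • e1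

theorem kappa_two_coeff_four (hp : p * p = p) (h0 : f 0 = p) (h1 : defect 2 b b a f 1 = 0)
    (h2 : defect 2 b b a f 2 = 0) (h3 : defect 2 b b a f 3 = 0) (h4 : defect 2 b b a f 4 = 0) :
    p * f 4 * (1 - p) = ((-1 / 12 : ℂ) • (p * a * f 1) - (1 / 6 : ℂ) • (p * b * f 2) +
      (1 / 24 : ℂ) • (p * b * b)) * (1 - p) := by
  have r1 := kappa_two_coeff_one hp h0 h1
  have r2 := kappa_two_coeff_two hp h0 h1 h2
  have r3 := kappa_two_coeff_two_mul hp h0 h1 h2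
  have r4 := kappa_two_coeff_three hp h0 h1 h2 h3
  rw [defect_four, h0, sub_eq_zero] at h4
  have e2 := idem_resOp_compl hp 2 4 (f 4)
  rw [h4] at e2
  simp only [mul_sub, sub_mul, mul_add, add_mul, mul_one, mul_zero, zero_mul, mul_assoc, smul_sub,
    smul_add, hp, mul_mul_of_mul_eq hp, r1, mul_mul_of_mul_eq r1, r2, r3, mul_mul_of_mul_eq r2,
    mul_mul_of_mul_eq r3, r4, mul_mul_of_mul_eq r4, mul_smul_comm, smul_mul_assoc] at e2 ⊢
  push_cast at e2
  linear_combination (norm := module) (1 / 4 : ℂ) • e2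

/-- The resonance k = 3 + κ = 5 after normalizing b = c. The coefficient `f 5` drops out, the free
coefficients cancel, and only the commutator condition is left. -/
theorem kappa_two_five (hp : p * p = p) (h0 : f 0 = p) (h1 : defect 2 b b a f 1 = 0)
    (h2 : defect 2 b b a f 2 = 0) (h3 : defect 2 b b a f 3 = 0) (h4 : defect 2 b b a f 4 = 0) :
    p * defect 2 b b a f 5 * (1 - p) = (-1 / 6 : ℂ) • (p * (b * a - a * b - (2 : ℂ) • b) * (1 - p)) := by
  have r1 := kappa_two_coeff_one hp h0 h1
  have r2 := kappa_two_coeff_two hp h0 h1 h2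
  have r3 := kappa_two_coeff_two_mul hp h0 h1 h2
  have r4 := kappa_two_coeff_three hp h0 h1 h2 h3
  have r5 := kappa_two_coeff_four hp h0 h1 h2 h3 h4
  rw [defect_three, h0, sub_eq_zero] at h3
  have e := compl_resOp_compl hp 2 3 (f 3)
  rw [h3] at e
  -- The remaining unknowns are p b (1 - p) `f 3` (1 - p) and p `f 4` `f 1` (1 - p). The first is
  -- supplied by the kernel block at k = 3, the second by the upper block at k = 4, because p `f 1`
  -- = 0.
  have e' := congrArg (fun w => p * b * w) e
  have e'' := congrArg (fun w => w * f 1 * (1 - p)) r5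
  have e1 := idem_resOp_compl hp 2 5 (f 5)
  rw [defect_five, h0, mul_sub p, sub_mul (p * _), e1]
  simp only [mul_sub, sub_mul, mul_add, add_mul, mul_one, mul_zero, zero_mul, mul_assoc, smul_sub,
    smul_add, hp, mul_mul_of_mul_eq hp, r1, mul_mul_of_mul_eq r1, r2, r3, mul_mul_of_mul_eq r2,
    r4, mul_mul_of_mul_eq r4, mul_smul_comm, smul_mul_assoc, one_mul]
    at e' e'' ⊢
  push_cast at e' e'' ⊢
  linear_combination (norm := skip) (1 / 6 : ℂ) • e' + (4 : ℂ) • e''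
  module
end KappaTwo

/-! ### Kernel block, and obstructions for κ = 0 and κ = 1 -/

variable {A : Type*} [Ring A] [Algebra ℂ A] {κ : ℂ} {p b c a : A} {f : ℕ → A}

theorem compl_defect_one_compl (hp : p * p = p) (h0 : f 0 = p) :
    (1 - p) * defect κ b c a f 1 * (1 - p) = 0 := by
  rw [defect_one, h0, compl_resOp_compl hp]
  simp

/-- Every term of the remainder begins or ends with p, except `f 1` p `f 1`, which p `f 1` = 0
kills. So the resonance k = 2 on the kernel is free of conditions. -/
theorem compl_defect_two_compl (hp : p * p = p) (h0 : f 0 = p) (h : p * f 1 = 0) :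
    (1 - p) * defect κ b c a f 2 * (1 - p) = 0 := by
  rw [defect_two, h0, mul_sub (1 - p), sub_mul ((1 - p) * _), compl_resOp_compl hp]
  simp only [mul_sub, sub_mul, mul_add, add_mul, mul_one, one_mul, mul_zero, zero_mul, mul_assoc,
    smul_sub, smul_add, hp, mul_mul_of_mul_eq hp, h, mul_mul_of_mul_eq h, mul_smul_comm,
    smul_mul_assoc]
  push_cast
  module

section SmallKappa

theorem idem_mul_coeff_one (hp : p * p = p) (h0 : f 0 = p) (hκ : κ + 2 ≠ 0)
    (h1 : defect κ b c a f 1 = 0) : p * f 1 = 0 := by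
  rw [defect_one, h0] at h1
  have e1 := idem_resOp_idem hp κ 1 (f 1)
  have e2 := idem_resOp_compl hp κ 1 (f 1)
  rw [h1] at e1 e2
  have e3 : p * f 1 * p = 0 := by
    push_cast at e1
    simp only [mul_zero, zero_mul] at e1
    linear_combination (norm := module) (1 / 6 : ℂ) • e1
  simp only [mul_sub, mul_one, e3, sub_zero, mul_zero, zero_mul] at e2
  refine (smul_eq_zero.1 e2.symm).resolve_left fun h => hκ ?_
  push_cast at h
  linear_combination -h

theorem coeff_one_mul_idem (hp : p * p = p) (h0 : f 0 = p) (hκ : κ - 2 ≠ 0)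
    (h1 : defect κ b c a f 1 = 0) : f 1 * p = 0 := by
  rw [defect_one, h0] at h1
  have e1 := idem_resOp_idem hp κ 1 (f 1)
  have e2 := compl_resOp_idem hp κ 1 (f 1)
  rw [h1] at e1 e2
  have e3 : p * f 1 * p = 0 := by
    push_cast at e1
    simp only [mul_zero, zero_mul] at e1
    linear_combination (norm := module) (1 / 6 : ℂ) • e1
  simp only [sub_mul, one_mul, e3, sub_zero, mul_zero, zero_mul] at e2
  refine (smul_eq_zero.1 e2.symm).resolve_left fun h => hκ ?_
  push_cast at h
  linear_combination h

/-- At the resonance k = 3 - κ = 2 the quadratic terms vanish, since both p `f 1` and `f 1` p are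
zero; only b remains. -/
theorem kappa_one_compl_defect_two_idem (hp : p * p = p) (h0 : f 0 = p)
    (h1 : defect 1 b c a f 1 = 0) :
    (1 - p) * defect 1 b c a f 2 * p = -((1 - p) * b * p) := by
  have r1 := idem_mul_coeff_one hp h0 (by norm_num) h1
  have r2 := coeff_one_mul_idem hp h0 (by norm_num) h1
  rw [defect_two, h0, mul_sub (1 - p), sub_mul ((1 - p) * _), compl_resOp_idem hp]
  simp only [mul_sub, sub_mul, mul_add, add_mul, one_mul, mul_assoc,
    smul_sub, hp, mul_mul_of_mul_eq hp, r1, r2, mul_zero, zero_mul,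
    mul_smul_comm, smul_mul_assoc]
  push_cast
  module

theorem kappa_one_coeff_two (hp : p * p = p) (h0 : f 0 = p) (h1 : defect 1 0 c a f 1 = 0)
    (h2 : defect 1 0 c a f 2 = 0) :
    p * f 2 = (1 / 12 : ℂ) • (p * (c * p)) - (1 / 4 : ℂ) • (p * c) := by
  have r1 := idem_mul_coeff_one hp h0 (by norm_num) h1
  have r2 := coeff_one_mul_idem hp h0 (by norm_num) h1
  rw [defect_two, h0, sub_eq_zero] at h2
  have e1 := idem_resOp_idem hp 1 2 (f 2)
  have e2 := idem_resOp_compl hp 1 2 (f 2)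
  rw [h2] at e1 e2
  simp only [mul_sub, mul_add, add_mul, mul_one, mul_zero, zero_mul, mul_assoc, smul_sub,
    mul_mul_of_mul_eq hp, r1, r2, mul_smul_comm, smul_mul_assoc] at e1 e2
  push_cast at e1 e2
  linear_combination (norm := module) (1 / 4 : ℂ) • e2 + (1 / 6 : ℂ) • e1

/-- The resonance k = 3 + κ = 4, with b already moved into c. It contains the kernel block of `f 2`,
which is free; this later forces c to be scalar. -/
theorem kappa_one_idem_defect_four_compl (hp : p * p = p) (h0 : f 0 = p)
    (h1 : defect 1 0 c a f 1 = 0) (h2 : defect 1 0 c a f 2 = 0) :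
    p * defect 1 0 c a f 4 * (1 - p) =
      p * c * (1 - p) * ((1 / 2 : ℂ) • (f 2 + f 1 * f 1) + (1 / 4 : ℂ) • c) * (1 - p) := by
  have r1 := idem_mul_coeff_one hp h0 (by norm_num) h1
  have r2 := coeff_one_mul_idem hp h0 (by norm_num) h1
  have r3 := kappa_one_coeff_two hp h0 h1 h2
  rw [defect_four, h0, mul_sub p, sub_mul (p * _), idem_resOp_compl hp]
  simp only [mul_sub, sub_mul, mul_add, add_mul, mul_one, mul_zero, zero_mul, mul_assoc,
    smul_sub, smul_add, hp, mul_mul_of_mul_eq hp, r1, r2, mul_mul_of_mul_eq r1,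
    r3, mul_mul_of_mul_eq r3, mul_smul_comm, smul_mul_assoc]
  push_cast
  module

theorem kappa_one_idem_defect_four_idem (hp : p * p = p) (h0 : f 0 = p)
    (h1 : defect 1 0 c a f 1 = 0) (h2 : defect 1 0 c a f 2 = 0) (hc : p * c = p * (c * p)) :
    p * defect 1 0 c a f 4 * p = 0 := by
  have r1 := idem_mul_coeff_one hp h0 (by norm_num) h1
  have r2 := coeff_one_mul_idem hp h0 (by norm_num) h1
  have r3 := kappa_one_coeff_two hp h0 h1 h2
  rw [hc] at r3
  rw [defect_four, h0, mul_sub p, sub_mul (p * _), idem_resOp_idem hp]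
  simp only [mul_sub, sub_mul, mul_add, add_mul, mul_zero, zero_mul, mul_assoc,
    smul_sub, smul_add, hp, mul_mul_of_mul_eq hp, r1, r2, mul_mul_of_mul_eq r1,
    r3, mul_mul_of_mul_eq r3, mul_smul_comm, smul_mul_assoc]
  push_cast
  module

theorem kappa_zero_coeff_two (hp : p * p = p) (h0 : f 0 = p) (h1 : defect 0 b c a f 1 = 0)
    (h2 : defect 0 b c a f 2 = 0) :
    p * f 2 = (1 / 3 : ℂ) • (p * (c * p)) - (1 / 6 : ℂ) • (p * (b * p)) - (1 / 2 : ℂ) • (p * c) := by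
  have r1 := idem_mul_coeff_one hp h0 (by norm_num) h1
  have r2 := coeff_one_mul_idem hp h0 (by norm_num) h1
  rw [defect_two, h0, sub_eq_zero] at h2
  have e1 := idem_resOp_idem hp 0 2 (f 2)
  have e2 := idem_resOp_compl hp 0 2 (f 2)
  rw [h2] at e1 e2
  simp only [mul_sub, mul_add, add_mul, mul_one, mul_zero, zero_mul, mul_assoc, smul_sub,
    hp, mul_mul_of_mul_eq hp, r1, r2, mul_smul_comm, smul_mul_assoc] at e1 e2
  push_cast at e1 e2
  linear_combination (norm := module) (1 / 2 : ℂ) • e2 + (1 / 6 : ℂ) • e1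

theorem kappa_zero_coeff_two_mul (hp : p * p = p) (h0 : f 0 = p) (h1 : defect 0 b c a f 1 = 0)
    (h2 : defect 0 b c a f 2 = 0) :
    f 2 * p = (1 / 3 : ℂ) • (p * (b * p)) - (1 / 6 : ℂ) • (p * (c * p)) - (1 / 2 : ℂ) • (b * p) := by
  have r1 := idem_mul_coeff_one hp h0 (by norm_num) h1
  have r2 := coeff_one_mul_idem hp h0 (by norm_num) h1
  rw [defect_two, h0, sub_eq_zero] at h2
  have e1 := idem_resOp_idem hp 0 2 (f 2)
  have e2 := compl_resOp_idem hp 0 2 (f 2)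
  rw [h2] at e1 e2
  simp only [sub_mul, mul_add, add_mul, one_mul, mul_zero, zero_mul, mul_assoc, smul_sub,
    hp, mul_mul_of_mul_eq hp, r1, r2, mul_smul_comm, smul_mul_assoc] at e1 e2
  push_cast at e1 e2
  linear_combination (norm := module) (1 / 2 : ℂ) • e2 + (1 / 6 : ℂ) • e1

/-- For κ = 0 both off-diagonal blocks resonate at k = 3. The coefficient `f 1` is free on the
kernel, so the condition separates into one on b - c and one on a. -/
theorem kappa_zero_idem_defect_three_compl (hp : p * p = p) (h0 : f 0 = p)
    (h1 : defect 0 b c a f 1 = 0) (h2 : defect 0 b c a f 2 = 0) :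
    p * defect 0 b c a f 3 * (1 - p) = -(p * (b - c) * f 1) - p * a * (1 - p) := by
  have r1 := idem_mul_coeff_one hp h0 (by norm_num) h1
  have r2 := coeff_one_mul_idem hp h0 (by norm_num) h1
  have r3 := kappa_zero_coeff_two hp h0 h1 h2
  rw [defect_three, h0, mul_sub p, sub_mul (p * _), idem_resOp_compl hp]
  simp only [mul_sub, sub_mul, mul_add, add_mul, mul_one, mul_zero, zero_mul, mul_assoc,
    smul_sub, hp, mul_mul_of_mul_eq hp, r1, r2, mul_mul_of_mul_eq r1,
    r3, mul_mul_of_mul_eq r3, mul_smul_comm, smul_mul_assoc]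
  push_cast
  module

theorem kappa_zero_compl_defect_three_idem (hp : p * p = p) (h0 : f 0 = p)
    (h1 : defect 0 b c a f 1 = 0) (h2 : defect 0 b c a f 2 = 0) :
    (1 - p) * defect 0 b c a f 3 * p = f 1 * (b - c) * p - (1 - p) * a * p := by
  have r1 := idem_mul_coeff_one hp h0 (by norm_num) h1
  have r2 := coeff_one_mul_idem hp h0 (by norm_num) h1
  have r3 := kappa_zero_coeff_two_mul hp h0 h1 h2
  rw [defect_three, h0, mul_sub (1 - p), sub_mul ((1 - p) * _), compl_resOp_idem hp]
  simp only [mul_sub, sub_mul, mul_add, add_mul, one_mul, mul_zero, zero_mul, mul_assoc,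
    smul_sub, hp, mul_mul_of_mul_eq hp, r1, r2, mul_mul_of_mul_eq r1, mul_mul_of_mul_eq r2,
    r3, mul_smul_comm, smul_mul_assoc]
  push_cast
  module

theorem kappa_zero_idem_defect_four_idem (hp : p * p = p) (h0 : f 0 = p)
    (h1 : defect 0 b b a f 1 = 0) (h2 : defect 0 b b a f 2 = 0) :
    p * defect 0 b b a f 4 * p = 0 := by
  have r1 := idem_mul_coeff_one hp h0 (by norm_num) h1
  have r2 := coeff_one_mul_idem hp h0 (by norm_num) h1
  have r3 := kappa_zero_coeff_two hp h0 h1 h2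
  have r4 := kappa_zero_coeff_two_mul hp h0 h1 h2
  rw [defect_four, h0, mul_sub p, sub_mul (p * _), idem_resOp_idem hp]
  simp only [mul_sub, sub_mul, mul_add, add_mul, mul_zero, zero_mul, mul_assoc,
    smul_sub, smul_add, hp, mul_mul_of_mul_eq hp, r1, r2, mul_mul_of_mul_eq r1,
    r3, r4, mul_mul_of_mul_eq r3, mul_smul_comm, smul_mul_assoc]
  push_cast
  module

end SmallKappa

/-- The eigenvalue of the resonance operator on the Peirce component with the eigenvalues `l`, `m`
of the residue. -/
def resEig (κ : ℂ) (k : ℕ) (l m : ℂ) : ℂ :=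
  ((k : ℂ) - 1) * (k - 2) - κ * k * (l - m) - 2 * (l ^ 2 + l * m + m ^ 2)

/-! ### Recursive solution with diagonal residue -/

section Diagonal

variable {n : ℕ} {R : Type*} [CommRing R] [Algebra ℂ R]

theorem resOp_diagonal_apply (κ : ℂ) (σ : Fin n → ℂ) (k : ℕ) (w : Matrix (Fin n) (Fin n) R)
    (r s : Fin n) :
    resOp κ (Matrix.diagonal fun i => algebraMap ℂ R (σ i)) k w r s =
      resEig κ k (σ r) (σ s) • w r s := by
  simp only [resOp, Matrix.diagonal_mul_diagonal, Matrix.sub_apply, Matrix.smul_apply, Matrix.add_apply,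
    Matrix.diagonal_mul, Matrix.mul_diagonal]
  simp only [resEig, Algebra.smul_def, map_sub, map_mul, map_add, map_pow, map_one, map_natCast, map_ofNat]
  ring

/-- Strong recursion along the equation with the residue `diagonal σ`; at resonances the
coefficients are prescribed by `x`. -/
noncomputable def recSol (κ : ℂ) (σ : Fin n → ℂ) (b c a : Matrix (Fin n) (Fin n) R)
    (x : ℕ → Fin n → Fin n → R) (k : ℕ) : Matrix (Fin n) (Fin n) R :=
  if k = 0 then Matrix.diagonal fun i => algebraMap ℂ R (σ i)
  else Matrix.of fun r s =>
    if resEig κ k (σ r) (σ s) = 0 then x k r s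
    else -(resEig κ k (σ r) (σ s))⁻¹ •
      defect κ b c a (fun i => if i < k then recSol κ σ b c a x i else 0) k r s
termination_by k

theorem recSol_zero (κ : ℂ) (σ : Fin n → ℂ) (b c a : Matrix (Fin n) (Fin n) R)
    (x : ℕ → Fin n → Fin n → R) :
    recSol κ σ b c a x 0 = Matrix.diagonal fun i => algebraMap ℂ R (σ i) := by
  rw [recSol, if_pos rfl]

theorem recSol_of_resEig_eq_zero {κ : ℂ} {σ : Fin n → ℂ} {b c a : Matrix (Fin n) (Fin n) R}
    {x : ℕ → Fin n → Fin n → R} {k : ℕ} (hk : 1 ≤ k) {r s : Fin n}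
    (h : resEig κ k (σ r) (σ s) = 0) : recSol κ σ b c a x k r s = x k r s := by
  rw [recSol, if_neg (by omega), Matrix.of_apply, if_pos h]

theorem defect_recSol_of_resEig_ne_zero {κ : ℂ} {σ : Fin n → ℂ}
    {b c a : Matrix (Fin n) (Fin n) R} {x : ℕ → Fin n → Fin n → R} {k : ℕ} (hk : 1 ≤ k)
    {r s : Fin n} (h : resEig κ k (σ r) (σ s) ≠ 0) :
    defect κ b c a (recSol κ σ b c a x) k r s = 0 := by
  have h1 := defect_sub_defect (κ := κ) (b := b) (c := c) (a := a)
    (f := recSol κ σ b c a x) (g := fun i => if i < k then recSol κ σ b c a x i else 0) hk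
    (fun i hi => by simp only [if_pos hi])
  have h2 := congrFun (congrFun h1 r) s
  simp only [if_pos (show 0 < k by omega), recSol_zero, resOp_diagonal_apply, if_neg (lt_irrefl k),
    sub_zero, Matrix.sub_apply] at h2
  rw [sub_eq_iff_eq_add] at h2
  rw [h2]
  conv_lhs => enter [1, 2]; rw [recSol]
  rw [if_neg (by omega), Matrix.of_apply]
  rw [if_neg h, smul_smul, mul_neg, mul_inv_cancel₀ h, neg_smul, one_smul, neg_add_cancel]

/-- Off the resonances the recursion divides by the eigenvalue. At a resonance `H` states that the
equation holds automatically, whatever value was prescribed. -/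
theorem defect_recSol {κ : ℂ} {σ : Fin n → ℂ} (hσ : ∀ i, σ i ^ 3 = σ i)
    {b c a : Matrix (Fin n) (Fin n) R} {x : ℕ → Fin n → Fin n → R}
    (H : ∀ f : ℕ → Matrix (Fin n) (Fin n) R,
      f 0 = Matrix.diagonal (fun i => algebraMap ℂ R (σ i)) → ∀ k, 1 ≤ k →
      (∀ i < k, defect κ b c a f i = 0) → ∀ r s, resEig κ k (σ r) (σ s) = 0 →
      defect κ b c a f k r s = 0) (k : ℕ) :
    defect κ b c a (recSol κ σ b c a x) k = 0 := by
  induction k using Nat.strong_induction_on with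
  | _ k ih =>
    rcases Nat.eq_zero_or_pos k with rfl | hk
    · rw [defect_zero, recSol_zero, Matrix.diagonal_mul_diagonal, Matrix.diagonal_mul_diagonal]
      have : (fun i => algebraMap ℂ R (σ i) * algebraMap ℂ R (σ i) * algebraMap ℂ R (σ i)) =
          fun i => algebraMap ℂ R (σ i) := by
        funext i
        rw [← map_mul, ← map_mul, ← pow_two, ← pow_succ, hσ]
      rw [this, sub_self, smul_zero]
    · ext r s
      by_cases h : resEig κ k (σ r) (σ s) = 0
      · exact H _ (recSol_zero ..) k hk ih r s h
      · exact defect_recSol_of_resEig_ne_zero hk h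

end Diagonal

/-! ### Vanishing of all obstructions for the normal forms -/

section Compatibility

variable {n : ℕ} {R : Type*} [CommRing R] [Algebra ℂ R]

/-- The normal forms of the coefficients for which no obstruction occurs at the resonances of
`y'' = κ [y, y'] + 2 y³ + X y + b y + y c + a`. -/
def IsNormal (κ : ℂ) (b c a : Matrix (Fin n) (Fin n) R) : Prop :=
  (κ = 0 ∧ b = c ∧ ∃ α : R, a = α • (1 : Matrix (Fin n) (Fin n) R)) ∨
  (κ = 1 ∧ b = 0 ∧ ∃ γ : R, c = γ • (1 : Matrix (Fin n) (Fin n) R)) ∨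
  (κ = 2 ∧ b = c ∧ ∃ γ : R, b * a - a * b - (2 : ℂ) • b = γ • (1 : Matrix (Fin n) (Fin n) R))

theorem IsNormal.conj {κ : ℂ} {b c a g g' : Matrix (Fin n) (Fin n) R} (h : IsNormal κ b c a)
    (hg : g * g' = 1) (hg' : g' * g = 1) :
    IsNormal κ (g' * b * g) (g' * c * g) (g' * a * g) := by
  have hs (γ : R) : g' * (γ • (1 : Matrix (Fin n) (Fin n) R)) * g = γ • 1 := by
    rw [mul_smul_comm, smul_mul_assoc, mul_one, hg']
  have hm (x y : Matrix (Fin n) (Fin n) R) : g' * x * g * (g' * y * g) = g' * (x * y) * g := by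
    rw [show g' * x * g * (g' * y * g) = g' * x * (g * g') * y * g by noncomm_ring, hg]
    noncomm_ring
  rcases h with ⟨h, rfl, α, rfl⟩ | ⟨h, rfl, γ, rfl⟩ | ⟨h, rfl, γ, e⟩
  · exact Or.inl ⟨h, rfl, α, hs α⟩
  · exact Or.inr (Or.inl ⟨h, by simp, γ, hs γ⟩)
  · refine Or.inr (Or.inr ⟨h, rfl, γ, ?_⟩)
    rw [hm, hm, ← hs γ, ← e]
    simp only [mul_sub, sub_mul, mul_smul_comm, smul_mul_assoc]

/-- The characteristic function of a point, with complex values. -/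
def indicatorAt (o i : Fin n) : ℂ := if i = o then 1 else 0

theorem indicatorAt_pow_three (o i : Fin n) : indicatorAt o i ^ 3 = indicatorAt o i := by
  unfold indicatorAt; split_ifs <;> norm_num

theorem diagonal_indicatorAt_mul_self (o : Fin n) :
    Matrix.diagonal (fun i => algebraMap ℂ R (indicatorAt o i)) *
      Matrix.diagonal (fun i => algebraMap ℂ R (indicatorAt o i)) =
      Matrix.diagonal (fun i => algebraMap ℂ R (indicatorAt o i)) := by
  rw [Matrix.diagonal_mul_diagonal]
  congr 1; funext i; unfold indicatorAt; split_ifs <;> simp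

theorem resEig_one_one_eq_zero {κ : ℂ} {k : ℕ} (h : resEig κ k 1 1 = 0) : k = 4 := by
  have h1 : ((k : ℂ) - 4) * (k + 1) = 0 := by rw [← h, resEig]; ring
  rcases mul_eq_zero.1 h1 with h2 | h2
  · exact_mod_cast sub_eq_zero.1 h2
  · exact absurd h2 (by exact_mod_cast k.succ_ne_zero)

theorem resEig_one_zero_eq_zero {κ : ℂ} {k : ℕ} (hk : 1 ≤ k) (h : resEig κ k 1 0 = 0) :
    (k : ℂ) = 3 + κ := by
  have h1 : (k : ℂ) * (k - 3 - κ) = 0 := by rw [← h, resEig]; ring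
  rcases mul_eq_zero.1 h1 with h2 | h2
  · rw [Nat.cast_eq_zero] at h2; omega
  · linear_combination h2

theorem resEig_zero_one_eq_zero {κ : ℂ} {k : ℕ} (hk : 1 ≤ k) (h : resEig κ k 0 1 = 0) :
    (k : ℂ) = 3 - κ := by
  have h1 : (k : ℂ) * (k - 3 + κ) = 0 := by rw [← h, resEig]; ring
  rcases mul_eq_zero.1 h1 with h2 | h2
  · rw [Nat.cast_eq_zero] at h2; omega
  · linear_combination h2

theorem resEig_zero_zero_eq_zero {κ : ℂ} {k : ℕ} (h : resEig κ k 0 0 = 0) : k = 1 ∨ k = 2 := by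
  have h1 : ((k : ℂ) - 1) * (k - 2) = 0 := by rw [← h, resEig]; ring
  rcases mul_eq_zero.1 h1 with h2 | h2
  · exact Or.inl (by exact_mod_cast sub_eq_zero.1 h2)
  · exact Or.inr (by exact_mod_cast sub_eq_zero.1 h2)

theorem IsNormal.idem_defect_four_idem {κ : ℂ} {b c a p : Matrix (Fin n) (Fin n) R}
    {f : ℕ → Matrix (Fin n) (Fin n) R} (h : IsNormal κ b c a) (hp : p * p = p) (h0 : f 0 = p)
    (hf : ∀ i < 4, defect κ b c a f i = 0) : p * defect κ b c a f 4 * p = 0 := by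
  rcases h with ⟨rfl, rfl, α, rfl⟩ | ⟨rfl, rfl, γ, rfl⟩ | ⟨rfl, rfl, γ, e⟩
  · exact kappa_zero_idem_defect_four_idem hp h0 (hf 1 (by omega)) (hf 2 (by omega))
  · exact kappa_one_idem_defect_four_idem hp h0 (hf 1 (by omega)) (hf 2 (by omega)) (by simp [hp])
  · rw [kappa_two_idem_defect_four_idem hp h0 (hf 1 (by omega)) (hf 2 (by omega))]
    simp

theorem IsNormal.idem_defect_compl {κ : ℂ} {b c a p : Matrix (Fin n) (Fin n) R}
    {f : ℕ → Matrix (Fin n) (Fin n) R} (h : IsNormal κ b c a) (hp : p * p = p) (h0 : f 0 = p)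
    {k : ℕ} (hk : (k : ℂ) = 3 + κ)
    (hf : ∀ i < k, defect κ b c a f i = 0) : p * defect κ b c a f k * (1 - p) = 0 := by
  rcases h with ⟨rfl, rfl, α, rfl⟩ | ⟨rfl, rfl, γ, rfl⟩ | ⟨rfl, rfl, γ, e⟩
  · obtain rfl : k = 3 := by rw [add_zero] at hk; exact_mod_cast hk
    rw [kappa_zero_idem_defect_three_compl hp h0 (hf 1 (by omega)) (hf 2 (by omega))]
    simp [mul_sub, hp]
  · obtain rfl : k = 4 := by norm_num at hk; exact_mod_cast hk
    rw [kappa_one_idem_defect_four_compl hp h0 (hf 1 (by omega)) (hf 2 (by omega))]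
    simp [mul_sub, hp]
  · obtain rfl : k = 5 := by norm_num at hk; exact_mod_cast hk
    rw [kappa_two_five hp h0 (hf 1 (by omega)) (hf 2 (by omega)) (hf 3 (by omega))
      (hf 4 (by omega)), e]
    simp [mul_sub, hp]

theorem IsNormal.compl_defect_idem {κ : ℂ} {b c a p : Matrix (Fin n) (Fin n) R}
    {f : ℕ → Matrix (Fin n) (Fin n) R} (h : IsNormal κ b c a) (hp : p * p = p) (h0 : f 0 = p)
    {k : ℕ} (hk : (k : ℂ) = 3 - κ)
    (hf : ∀ i < k, defect κ b c a f i = 0) : (1 - p) * defect κ b c a f k * p = 0 := by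
  rcases h with ⟨rfl, rfl, α, rfl⟩ | ⟨rfl, rfl, γ, rfl⟩ | ⟨rfl, rfl, γ, e⟩
  · obtain rfl : k = 3 := by rw [sub_zero] at hk; exact_mod_cast hk
    rw [kappa_zero_compl_defect_three_idem hp h0 (hf 1 (by omega)) (hf 2 (by omega))]
    simp [sub_mul, hp]
  · obtain rfl : k = 2 := by norm_num at hk; exact_mod_cast hk
    rw [kappa_one_compl_defect_two_idem hp h0 (hf 1 (by omega))]
    simp
  · obtain rfl : k = 1 := by norm_num at hk; exact_mod_cast hk
    rw [defect_one, h0, compl_resOp_idem hp]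
    norm_num

theorem IsNormal.idem_mul_coeff_one {κ : ℂ} {b c a p : Matrix (Fin n) (Fin n) R}
    {f : ℕ → Matrix (Fin n) (Fin n) R} (h : IsNormal κ b c a) (hp : p * p = p) (h0 : f 0 = p)
    (hf : defect κ b c a f 1 = 0) : p * f 1 = 0 := by
  refine MatrixPainleveTwo.idem_mul_coeff_one hp h0 ?_ hf
  rcases h with ⟨rfl, -⟩ | ⟨rfl, -⟩ | ⟨rfl, -⟩ <;> norm_num

theorem IsNormal.defect_eq_zero_at_resonance {κ : ℂ} {b c a : Matrix (Fin n) (Fin n) R}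
    (h : IsNormal κ b c a) (o : Fin n) (f : ℕ → Matrix (Fin n) (Fin n) R)
    (h0 : f 0 = Matrix.diagonal (fun i => algebraMap ℂ R (indicatorAt o i))) (k : ℕ) (hk : 1 ≤ k)
    (hf : ∀ i < k, defect κ b c a f i = 0) (r s : Fin n)
    (he : resEig κ k (indicatorAt o r) (indicatorAt o s) = 0) :
    defect κ b c a f k r s = 0 := by
  have hp := diagonal_indicatorAt_mul_self (R := R) o
  have hq : (1 : Matrix (Fin n) (Fin n) R) -
      Matrix.diagonal (fun i => algebraMap ℂ R (indicatorAt o i)) =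
      Matrix.diagonal (fun i => 1 - algebraMap ℂ R (indicatorAt o i)) := by
    rw [← Matrix.diagonal_one, Matrix.diagonal_sub]
  by_cases hr : r = o <;> by_cases hs : s = o <;>
    simp only [indicatorAt, hr, hs, if_true, if_false] at he
  · obtain rfl := resEig_one_one_eq_zero he
    have := congrFun (congrFun (h.idem_defect_four_idem hp h0 hf) r) s
    simpa [Matrix.diagonal_mul, Matrix.mul_diagonal, indicatorAt, hr, hs]
      using this
  · have := congrFun (congrFun (h.idem_defect_compl hp h0 (resEig_one_zero_eq_zero hk he) hf) r) s
    rw [hq] at this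
    simpa [Matrix.diagonal_mul, Matrix.mul_diagonal, indicatorAt, hr, hs] using this
  · have := congrFun (congrFun (h.compl_defect_idem hp h0 (resEig_zero_one_eq_zero hk he) hf) r) s
    rw [hq] at this
    simpa [Matrix.diagonal_mul, Matrix.mul_diagonal, indicatorAt, hr, hs] using this
  · rcases resEig_zero_zero_eq_zero he with rfl | rfl
    · have := congrFun (congrFun (compl_defect_one_compl (κ := κ) (b := b) (c := c) (a := a)
        hp h0) r) s
      rw [hq] at this
      simpa [Matrix.diagonal_mul, Matrix.mul_diagonal, indicatorAt, hr, hs] using this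
    · have := congrFun (congrFun (compl_defect_two_compl (κ := κ) (b := b) (c := c) (a := a)
        hp h0 (h.idem_mul_coeff_one hp h0 (hf 1 (by omega)))) r) s
      rw [hq] at this
      simpa [Matrix.diagonal_mul, Matrix.mul_diagonal, indicatorAt, hr, hs] using this

end Compatibility

/-! ### Homomorphisms, y ↦ -y, and moving scalars between b and c -/

section Symmetries

variable {A A' : Type*} [Ring A] [Algebra ℂ A] [Ring A'] [Algebra ℂ A']

theorem map_conv (φ : A →ₐ[ℂ] A') (f g : ℕ → A) (k : ℕ) :
    φ (conv f g k) = conv (fun i => φ (f i)) (fun i => φ (g i)) k := by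
  simp [conv]

theorem map_defect (φ : A →ₐ[ℂ] A') (κ : ℂ) (b c a : A) (f : ℕ → A) (k : ℕ) :
    φ (defect κ b c a f k) = defect κ (φ b) (φ c) (φ a) (fun i => φ (f i)) k := by
  have h1 : (fun i => φ (theta f i)) = theta fun i => φ (f i) := by
    funext i; simp [theta]
  simp only [defect, map_sub, map_smul, map_conv, h1, apply_ite φ, map_add, map_mul, map_zero]

theorem defect_neg (κ : ℂ) (b c a : A) (f : ℕ → A) (k : ℕ) :
    defect (-κ) b c (-a) (fun i => -f i) k = -defect κ b c a f k := by
  have h1 (f g : ℕ → A) (k : ℕ) : conv (fun i => -f i) (fun i => -g i) k = conv f g k := by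
    simp [conv]
  have h2 : (theta fun i => -f i) = fun i => -theta f i := by
    funext i; simp [theta]
  have h3 : conv (conv (fun i => -f i) fun i => -f i) (fun i => -f i) k =
      -conv (conv f f) f k := by
    rw [show (conv (fun i => -f i) fun i => -f i) = conv f f from funext (h1 f f)]
    simp [conv]
  rw [defect, defect, h2, h1, h1, h3]
  split_ifs <;> simp only [mul_neg, neg_mul, smul_neg] <;> module

theorem defect_add_sub (κ : ℂ) (m : ℂ) (b c a : A) (f : ℕ → A) (k : ℕ) :
    defect κ (b + m • (1 : A)) (c - m • (1 : A)) a f k = defect κ b c a f k := by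
  have (x : A) : (b + m • (1 : A)) * x + x * (c - m • (1 : A)) = b * x + x * c := by
    rw [add_mul, mul_sub, smul_mul_assoc, mul_smul_comm, one_mul, mul_one]
    abel
  simp only [defect, this]

/-- Conjugation by an invertible element. -/
noncomputable def conjHom (g g' : A) (hg : g * g' = 1) (hg' : g' * g = 1) : A →ₐ[ℂ] A :=
  AlgHom.ofLinearMap (LinearMap.mulLeftRight ℂ (g, g')) (by simp [hg]) (fun x y => by
    simp only [LinearMap.mulLeftRight_apply]
    rw [show g * x * g' * (g * y * g') = g * x * (g' * g) * y * g' by noncomm_ring, hg']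
    noncomm_ring)

theorem conjHom_apply {g g' : A} (hg : g * g' = 1) (hg' : g' * g = 1) (x : A) :
    conjHom g g' hg hg' x = g * x * g' := rfl

end Symmetries

theorem IsNormal.map {n : ℕ} {R R' : Type*} [CommRing R] [Algebra ℂ R] [CommRing R'] [Algebra ℂ R']
    {κ : ℂ} {b c a : Matrix (Fin n) (Fin n) R} (h : IsNormal κ b c a) (φ : R →ₐ[ℂ] R') :
    IsNormal κ (φ.mapMatrix b) (φ.mapMatrix c) (φ.mapMatrix a) := by
  have hs (α : R) : φ.mapMatrix (α • (1 : Matrix (Fin n) (Fin n) R)) = φ α • 1 := by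
    ext i j; simp [Matrix.one_apply, apply_ite φ]
  rcases h with ⟨h, rfl, α, rfl⟩ | ⟨h, rfl, γ, rfl⟩ | ⟨h, rfl, γ, e⟩
  · exact Or.inl ⟨h, rfl, φ α, hs α⟩
  · exact Or.inr (Or.inl ⟨h, map_zero _, φ γ, hs γ⟩)
  · refine Or.inr (Or.inr ⟨h, rfl, φ γ, ?_⟩)
    rw [← hs, ← e, map_sub, map_sub, map_mul, map_mul, map_smul]

theorem isAlgebraic_of_mul_eq {R : Type*} [CommRing R] [Algebra ℂ R] {B : Subalgebra ℂ R}
    {x y z : R} (hx0 : x ≠ 0) (hx : x ∈ B) (hy : y ∈ B) (h : z * x = y) : IsAlgebraic B z := by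
  have hx0' : (⟨x, hx⟩ : B) ≠ 0 := fun h0 => hx0 (congrArg Subtype.val h0)
  refine ⟨Polynomial.C ⟨x, hx⟩ * Polynomial.X - Polynomial.C ⟨y, hy⟩, fun h0 => ?_, ?_⟩
  · have := congrArg (fun p => Polynomial.coeff p 1) h0
    simp only [Polynomial.coeff_sub, Polynomial.coeff_C_mul, Polynomial.coeff_X_one, mul_one,
      Polynomial.coeff_C_succ, sub_zero, Polynomial.coeff_zero] at this
    exact hx0' this
  · simp only [map_sub, map_mul, Polynomial.aeval_C, Polynomial.aeval_X]
    change x * z - y = 0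
    rw [mul_comm, h, sub_self]

/-! ### The universal family and its parameters -/

section Universal

variable {n : ℕ} (o : Fin n)

/-- The index type of the free parameters of the solutions. -/
abbrev Par : Type := {q : Fin n × Fin n × Bool // q ≠ (o, o, false)}

open Classical in
/-- The free parameters, completed by a zero. -/
noncomputable def par (q : Fin n × Fin n × Bool) : MvPolynomial (Par o) ℂ :=
  if h : q ≠ (o, o, false) then MvPolynomial.X ⟨q, h⟩ else 0

/-- The column of parameters that moves the image of the residue. -/
noncomputable def parCol : Matrix (Fin n) (Fin n) (MvPolynomial (Par o) ℂ) :=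
  Matrix.of fun r s => if s = o ∧ r ≠ o then par o (r, o, false) else 0

/-- The row of parameters that moves the kernel of the residue. -/
noncomputable def parRow : Matrix (Fin n) (Fin n) (MvPolynomial (Par o) ℂ) :=
  Matrix.of fun r s => if r = o ∧ s ≠ o then par o (o, s, false) else 0

theorem parCol_mul_self : parCol o * parCol o = 0 := by
  ext1 r s
  rw [Matrix.mul_apply, Matrix.zero_apply]
  refine sum_eq_zero fun j _ => ?_
  by_cases hj : j = o <;> simp [parCol, hj]

theorem parRow_mul_self : parRow o * parRow o = 0 := by
  ext1 r s
  rw [Matrix.mul_apply, Matrix.zero_apply]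
  refine sum_eq_zero fun j _ => ?_
  by_cases hj : j = o <;> simp [parRow, hj]

/-- The generic conjugating matrix. -/
noncomputable def parConj : Matrix (Fin n) (Fin n) (MvPolynomial (Par o) ℂ) :=
  (1 + parCol o) * (1 + parRow o)

/-- The inverse of the generic conjugating matrix. -/
noncomputable def parConjInv : Matrix (Fin n) (Fin n) (MvPolynomial (Par o) ℂ) :=
  (1 - parRow o) * (1 - parCol o)

theorem parConj_mul_parConjInv : parConj o * parConjInv o = 1 := by
  have h1 : (1 + parRow o) * (1 - parRow o) = 1 := by
    rw [show (1 + parRow o) * (1 - parRow o) = 1 - parRow o * parRow o by noncomm_ring,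
      parRow_mul_self, sub_zero]
  have h2 : (1 + parCol o) * (1 - parCol o) = 1 := by
    rw [show (1 + parCol o) * (1 - parCol o) = 1 - parCol o * parCol o by noncomm_ring,
      parCol_mul_self, sub_zero]
  rw [parConj, parConjInv, mul_assoc, ← mul_assoc (1 + parRow o), h1, one_mul, h2]

theorem parConjInv_mul_parConj : parConjInv o * parConj o = 1 := by
  exact mul_eq_one_comm.1 (parConj_mul_parConjInv o)

/-- The generic residue. -/
noncomputable def parResidue : Matrix (Fin n) (Fin n) (MvPolynomial (Par o) ℂ) :=
  parConj o * Matrix.diagonal (fun i => algebraMap ℂ _ (indicatorAt o i)) * parConjInv o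

/-- The first factor does not change row `o`, so the row parameters are entries of the residue up to
sign, and the column parameters are quotients by its (`o`, `o`) entry. -/
theorem parResidue_eq : parResidue o = (1 + parCol o) *
    (Matrix.diagonal (fun i => algebraMap ℂ _ (indicatorAt o i)) - parRow o +
      parRow o * parCol o) := by
  set e : Matrix (Fin n) (Fin n) (MvPolynomial (Par o) ℂ) :=
    Matrix.diagonal (fun i => algebraMap ℂ _ (indicatorAt o i)) with he
  have h1 : parRow o * e = 0 := by
    ext1 r s
    rw [he, Matrix.mul_diagonal]
    by_cases hs : s = o <;> simp [parRow, indicatorAt, hs]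
  have h2 : e * parRow o = parRow o := by
    ext1 r s
    rw [he, Matrix.diagonal_mul]
    by_cases hr : r = o <;> simp [parRow, indicatorAt, hr]
  have h3 : e * parCol o = 0 := by
    ext1 r s
    rw [he, Matrix.diagonal_mul]
    by_cases hr : r = o <;> simp [parCol, indicatorAt, hr]
  have h4 : (1 + parRow o) * e * (1 - parRow o) * (1 - parCol o) =
      e - parRow o + parRow o * parCol o := by
    rw [add_mul, one_mul, h1, add_zero, mul_sub e, mul_one, h2, mul_sub (e - _), mul_one, sub_mul e, h3]
    abel
  rw [parResidue, ← he, parConj, parConjInv, ← h4]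
  simp only [mul_assoc]

theorem parResidue_row {s : Fin n} (hs : s ≠ o) : parResidue o o s = -par o (o, s, false) := by
  have h1 : ∀ x : Matrix (Fin n) (Fin n) (MvPolynomial (Par o) ℂ), (parCol o * x) o s = 0 := by
    intro x
    rw [Matrix.mul_apply]
    exact sum_eq_zero fun j _ => by simp [parCol]
  rw [parResidue_eq, add_mul, one_mul, Matrix.add_apply, h1, add_zero, Matrix.add_apply,
    Matrix.sub_apply, Matrix.diagonal_apply_ne' _ hs, Matrix.mul_apply]
  rw [sum_eq_zero fun j _ => by simp [parCol, hs]]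
  simp [parRow, hs]

theorem parResidue_col {r : Fin n} (hr : r ≠ o) :
    parResidue o r o = par o (r, o, false) * parResidue o o o := by
  have h1 : ∀ x : Matrix (Fin n) (Fin n) (MvPolynomial (Par o) ℂ), (parCol o * x) o o = 0 := by
    intro x
    rw [Matrix.mul_apply]
    exact sum_eq_zero fun j _ => by simp [parCol]
  have h2 : ∀ x : Matrix (Fin n) (Fin n) (MvPolynomial (Par o) ℂ),
      (parCol o * x) r o = par o (r, o, false) * x o o := by
    intro x
    rw [Matrix.mul_apply, sum_eq_single o (fun j _ hj => by simp [parCol, hj]) (by simp)]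
    simp [parCol, hr]
  have h3 : (parRow o * parCol o) r o = 0 := by
    rw [Matrix.mul_apply]
    exact sum_eq_zero fun j _ => by simp [parRow, hr]
  rw [parResidue_eq]
  set M := Matrix.diagonal (fun i => algebraMap ℂ (MvPolynomial (Par o) ℂ) (indicatorAt o i)) -
    parRow o + parRow o * parCol o with hM
  have h4 : M r o = 0 := by
    rw [hM, Matrix.add_apply, Matrix.sub_apply, h3, Matrix.diagonal_apply_ne _ hr]
    simp [parRow, hr]
  rw [add_mul, one_mul, Matrix.add_apply, Matrix.add_apply, h1, h2, h4, zero_add, add_zero]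

theorem parResidue_ne_zero : parResidue o o o ≠ 0 := by
  intro h
  -- At the origin of the parameter space the residue is the diagonal unit, whose (`o`, `o`) entry
  -- is 1.
  have h1 : (parResidue o).map (MvPolynomial.aeval (fun _ : Par o => (0 : ℂ))) o o = 0 := by
    rw [Matrix.map_apply, h, map_zero]
  have hp : ∀ q, MvPolynomial.constantCoeff (par o q) = 0 := by
    intro q; unfold par; split_ifs <;> simp
  rw [parResidue_eq, Matrix.map_apply, Matrix.mul_apply, map_sum, sum_eq_single o] at h1
  · simp [parCol, parRow, indicatorAt, Matrix.mul_apply] at h1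
    rw [sum_eq_zero] at h1
    · simp at h1
    · intro j _; split_ifs <;> simp [hp]
  · intro j _ hj
    simp [parCol, hj, Ne.symm hj]
  · simp

/-- The prescribed values of the solution at the resonances. -/
noncomputable def parData (k : ℕ) (r s : Fin n) : MvPolynomial (Par o) ℂ :=
  par o (r, s, if k = 1 ∧ r ≠ o ∧ s ≠ o then false else true)

/-- The universal family of solutions. -/
noncomputable def universalSol (ε κ : ℂ) (b c a : Mat n) (k : ℕ) :
    Matrix (Fin n) (Fin n) (MvPolynomial (Par o) ℂ) :=
  let φ : Mat n →ₐ[ℂ] Matrix (Fin n) (Fin n) (MvPolynomial (Par o) ℂ) :=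
    (Algebra.ofId ℂ (MvPolynomial (Par o) ℂ)).mapMatrix
  ε • (parConj o * recSol κ (indicatorAt o) (parConjInv o * φ b * parConj o)
    (parConjInv o * φ c * parConj o) (parConjInv o * φ a * parConj o) (parData o) k *
      parConjInv o)

theorem universalSol_zero (ε κ : ℂ) (b c a : Mat n) :
    universalSol o ε κ b c a 0 = ε • parResidue o := by
  rw [universalSol, recSol_zero, parResidue]

theorem defect_universalSol {ε κ : ℂ} {b c a : Mat n} (hε : ε = 1 ∨ ε = -1)
    (h : IsNormal κ b c a) (k : ℕ) :
    let φ : Mat n →ₐ[ℂ] Matrix (Fin n) (Fin n) (MvPolynomial (Par o) ℂ) :=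
      (Algebra.ofId ℂ (MvPolynomial (Par o) ℂ)).mapMatrix
    defect (ε * κ) (φ b) (φ c) (φ (ε • a)) (universalSol o ε κ b c a) k = 0 := by
  intro φ
  have h1 := (h.map (Algebra.ofId ℂ (MvPolynomial (Par o) ℂ))).conj
    (parConj_mul_parConjInv o) (parConjInv_mul_parConj o)
  have h2 := defect_recSol (indicatorAt_pow_three o) (x := parData o)
    (h1.defect_eq_zero_at_resonance o) k
  have h3 := congrArg (conjHom (parConj o) (parConjInv o) (parConj_mul_parConjInv o)
    (parConjInv_mul_parConj o)) h2
  rw [map_defect, map_zero] at h3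
  have h4 (x : Matrix (Fin n) (Fin n) (MvPolynomial (Par o) ℂ)) :
      parConj o * (parConjInv o * x * parConj o) * parConjInv o = x := by
    rw [show parConj o * (parConjInv o * x * parConj o) * parConjInv o =
      (parConj o * parConjInv o) * x * (parConj o * parConjInv o) by simp only [mul_assoc],
      parConj_mul_parConjInv, one_mul, mul_one]
  simp only [conjHom_apply, h4] at h3
  rcases hε with rfl | rfl
  · rw [one_mul, one_smul]
    convert h3 using 2
    funext i
    rw [universalSol, one_smul]
  · rw [neg_one_mul, neg_one_smul, map_neg]
    rw [← neg_eq_zero, ← defect_neg] at h3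
    convert h3 using 2
    funext i
    rw [universalSol, neg_one_smul]

theorem IsNormal.exists_resonances {κ : ℂ} {b c a : Mat n} (h : IsNormal κ b c a) :
    (∃ k : ℕ, 1 ≤ k ∧ (k : ℂ) = 3 + κ) ∧ ∃ k : ℕ, 1 ≤ k ∧ (k : ℂ) = 3 - κ := by
  rcases h with ⟨rfl, -⟩ | ⟨rfl, -⟩ | ⟨rfl, -⟩
  · exact ⟨⟨3, by norm_num, by norm_num⟩, ⟨3, by norm_num, by norm_num⟩⟩
  · exact ⟨⟨4, by norm_num, by norm_num⟩, ⟨2, by norm_num, by norm_num⟩⟩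
  · exact ⟨⟨5, by norm_num, by norm_num⟩, ⟨1, by norm_num, by norm_num⟩⟩

/-- The residue recovers the conjugating matrix up to algebraic elements. Conjugating back recovers
the diagonal-residue solution, whose resonant entries are the other parameters. -/
theorem isAlgebraic_universalSol {ε κ : ℂ} {b c a : Mat n} (hε : ε = 1 ∨ ε = -1)
    (h : IsNormal κ b c a) :
    Algebra.IsAlgebraic
      (Algebra.adjoin ℂ (Set.range fun e : ℕ × Fin n × Fin n =>
        universalSol o ε κ b c a e.1 e.2.1 e.2.2)) (MvPolynomial (Par o) ℂ) := by
  set S := Set.range fun e : ℕ × Fin n × Fin n => universalSol o ε κ b c a e.1 e.2.1 e.2.2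
  let L := Subalgebra.algebraicClosure (Algebra.adjoin ℂ S) (MvPolynomial (Par o) ℂ)
  have hadj : ∀ x ∈ Algebra.adjoin ℂ S, x ∈ L := fun x hx => L.algebraMap_mem ⟨x, hx⟩
  have hF : ∀ k r s, universalSol o ε κ b c a k r s ∈ Algebra.adjoin ℂ S := fun k r s =>
    Algebra.subset_adjoin ⟨(k, r, s), rfl⟩
  have hsm : ∀ x : Matrix (Fin n) (Fin n) (MvPolynomial (Par o) ℂ), ε • ε • x = x := by
    intro x
    rcases hε with rfl | rfl <;> simp
  have hF' : ∀ k r s, (ε • universalSol o ε κ b c a k) r s ∈ Algebra.adjoin ℂ S := fun k r s =>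
    Subalgebra.smul_mem _ (hF k r s) ε
  have hmul : ∀ x y : Matrix (Fin n) (Fin n) (MvPolynomial (Par o) ℂ), (∀ r s, x r s ∈ L) →
      (∀ r s, y r s ∈ L) → ∀ r s, (x * y) r s ∈ L := by
    intro x y hx hy r s
    rw [Matrix.mul_apply]
    exact sum_mem fun j _ => mul_mem (hx _ _) (hy _ _)
  have hone : ∀ r s, (1 : Matrix (Fin n) (Fin n) (MvPolynomial (Par o) ℂ)) r s ∈ L := by
    intro r s
    rw [Matrix.one_apply]
    split_ifs
    exacts [one_mem _, zero_mem _]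
  have hres : ∀ r s, parResidue o r s ∈ Algebra.adjoin ℂ S := by
    intro r s
    have := hF' 0 r s
    rwa [universalSol_zero, hsm] at this
  have hrow : ∀ s, s ≠ o → par o (o, s, false) ∈ L := by
    intro s hs
    have := hadj _ (hres o s)
    rw [parResidue_row o hs] at this
    simpa using neg_mem this
  have hcol : ∀ r, r ≠ o → par o (r, o, false) ∈ L := by
    intro r hr
    rw [Subalgebra.mem_algebraicClosure]
    exact isAlgebraic_of_mul_eq (parResidue_ne_zero o) (hres o o) (hres r o)
      (parResidue_col o hr).symm
  have hparCol : ∀ r s, parCol o r s ∈ L := by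
    intro r s
    by_cases hs : s = o ∧ r ≠ o
    · simpa [parCol, hs] using hcol r hs.2
    · simp [parCol, hs]
  have hparRow : ∀ r s, parRow o r s ∈ L := by
    intro r s
    by_cases hs : r = o ∧ s ≠ o
    · simpa [parRow, hs] using hrow s hs.2
    · simp [parRow, hs]
  have hg : ∀ r s, parConj o r s ∈ L := hmul _ _
    (fun r s => add_mem (hone r s) (hparCol r s)) (fun r s => add_mem (hone r s) (hparRow r s))
  have hg' : ∀ r s, parConjInv o r s ∈ L := hmul _ _
    (fun r s => sub_mem (hone r s) (hparRow r s)) (fun r s => sub_mem (hone r s) (hparCol r s))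
  have hdata : ∀ k, 1 ≤ k → ∀ r s, resEig κ k (indicatorAt o r) (indicatorAt o s) = 0 →
      parData o k r s ∈ L := by
    intro k hk r s he
    have h1 := hmul _ _ (hmul _ _ hg' (fun r s => hadj _ (hF' k r s))) hg r s
    rw [universalSol, hsm] at h1
    rw [show ∀ x : Matrix (Fin n) (Fin n) (MvPolynomial (Par o) ℂ),
      parConjInv o * (parConj o * x * parConjInv o) * parConj o =
      (parConjInv o * parConj o) * x * (parConjInv o * parConj o) by
        intro x; simp only [mul_assoc], parConjInv_mul_parConj, one_mul, mul_one,
      recSol_of_resEig_eq_zero hk he] at h1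
    exact h1
  -- The resonances used are 4 on (o, o), 3 + κ on row o, 3 - κ on column o, and 1, 2 on the rest.
  -- With the 2(n - 1) residue parameters they account for all of `Par o`.
  have hpar : ∀ q, q ≠ (o, o, false) → par o q ∈ L := by
    rintro ⟨r, s, t⟩ hq
    by_cases hr : r = o <;> by_cases hs : s = o <;> cases t
    · simp [hr, hs] at hq
    · have := hdata 4 (by norm_num) r s (by simp [indicatorAt, hr, hs, resEig]; norm_num)
      simpa [parData] using this
    · rw [hr]; exact hrow s hs
    · obtain ⟨k, hk, e⟩ := h.exists_resonances.1
      have := hdata k hk r s (by simp only [indicatorAt, hr, hs, resEig, if_true, if_false, e]; ring)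
      simpa [parData, hr] using this
    · rw [hs]; exact hcol r hr
    · obtain ⟨k, hk, e⟩ := h.exists_resonances.2
      have := hdata k hk r s (by simp only [indicatorAt, hr, hs, resEig, if_true, if_false, e]; ring)
      simpa [parData, hs] using this
    · have := hdata 1 le_rfl r s (by simp [indicatorAt, hr, hs, resEig])
      simpa [parData, hr, hs] using this
    · have := hdata 2 (by norm_num) r s (by simp [indicatorAt, hr, hs, resEig])
      simpa [parData] using this
  refine ⟨fun x => ?_⟩
  change x ∈ L
  induction x using MvPolynomial.induction_on with
  | C z => exact hadj _ (Subalgebra.algebraMap_mem _ z)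
  | add x y hx hy => exact add_mem hx hy
  | mul_X x q hx =>
    refine mul_mem hx ?_
    have := hpar q.1 q.2
    rwa [par, dif_pos q.2] at this

theorem card_par (o : Fin n) : Fintype.card (Par o) = 2 * n ^ 2 - 1 := by
  rw [Fintype.card_subtype_compl, Fintype.card_subtype_eq]
  simp
  ring_nf

end Universal

/-! ### Sufficiency of the normal forms -/

theorem containsConstants_of_isNormal {n : ℕ} (o : Fin n) {ε κ : ℂ} {b c a : Mat n}
    (hε : ε = 1 ∨ ε = -1) (h : IsNormal κ b c a) {κ' z₀ : ℂ} {b₁ b₂ a' : Mat n}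
    (hd : ∀ (f : ℕ → Mat n) k,
      defect κ' (b₁ + z₀ • (1 : Mat n)) b₂ a' f k = defect (ε * κ) b c (ε • a) f k) :
    ContainsConstants κ' b₁ b₂ a' z₀ (2 * n ^ 2 - 1) := by
  set F := universalSol o ε κ b c a with hF
  have hpt : ∀ x : Par o → ℂ, IsPolarSolution κ' b₁ b₂ a' z₀
      (shifted (-1) fun k => (MvPolynomial.aeval (R := ℂ) x).mapMatrix (F k)) := by
    intro x
    rw [isPolarSolution_shifted]
    have hx : ∀ m : Mat n, (MvPolynomial.aeval (R := ℂ) x).mapMatrix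
        ((Algebra.ofId ℂ (MvPolynomial (Par o) ℂ)).mapMatrix m) = m := by
      intro m
      ext i j
      simp [Algebra.ofId_apply]
    constructor
    · intro h0
      have h1 : (MvPolynomial.aeval (R := ℂ) x).mapMatrix (parResidue o) = 0 := by
        rw [hF, universalSol_zero, map_smul] at h0
        rcases hε with rfl | rfl <;> simpa using h0
      have h2 := congrArg (MvPolynomial.aeval (R := ℂ) x).mapMatrix (show
        parConjInv o * parResidue o * parConj o =
          Matrix.diagonal (fun i => algebraMap ℂ _ (indicatorAt o i)) by
        rw [parResidue, show ∀ x : Matrix (Fin n) (Fin n) (MvPolynomial (Par o) ℂ),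
          parConjInv o * (parConj o * x * parConjInv o) * parConj o =
          (parConjInv o * parConj o) * x * (parConjInv o * parConj o) by
            intro x; simp only [mul_assoc], parConjInv_mul_parConj, one_mul, mul_one])
      rw [map_mul, map_mul, h1, mul_zero, zero_mul] at h2
      have h3 := congrFun (congrFun h2 o) o
      simp [indicatorAt] at h3
    · intro k
      rw [hd]
      have h1 := congrArg (MvPolynomial.aeval (R := ℂ) x).mapMatrix
        (defect_universalSol o hε h k)
      rwa [map_defect, map_zero, hx, hx, hx] at h1
  let y : (Par o → ℂ) → PolarSolution κ' b₁ b₂ a' z₀ := fun x => ⟨_, hpt x⟩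
  have := isAlgebraic_universalSol o hε h
  -- The polynomial ring is algebraic over the algebra of coefficients, so a transcendence basis can
  -- be chosen among them; it has as many elements as there are variables.
  obtain ⟨t, ht, hb⟩ := exists_isTranscendenceBasis_subset (R := ℂ)
    (Set.range fun e : ℕ × Fin n × Fin n => F e.1 e.2.1 e.2.2)
  have hcard : Cardinal.mk t = Cardinal.mk (Par o) :=
    hb.cardinalMk_eq (IsTranscendenceBasis.mvPolynomial (Par o) ℂ)
  obtain ⟨eq⟩ := Cardinal.eq.1 hcard
  let eq' : Fin (2 * n ^ 2 - 1) ≃ t :=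
    (Fintype.equivFinOfCardEq (card_par o)).symm.trans eq.symm
  choose idx hidx using fun u : t => ht u.2
  refine ⟨fun i => (-1 + (idx (eq' i)).1, (idx (eq' i)).2), ?_⟩
  let H : MvPolynomial (Par o) ℂ →ₐ[ℂ] ((Par o → ℂ) → ℂ) :=
    AlgHom.pi fun x => MvPolynomial.aeval x
  let G : (PolarSolution κ' b₁ b₂ a' z₀ → ℂ) →ₐ[ℂ] ((Par o → ℂ) → ℂ) :=
    AlgHom.pi fun x => Pi.evalAlgHom ℂ _ (y x)
  -- Over the infinite field ℂ polynomials are determined by their values. Thus independence passes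
  -- to functions of the parameters, and then back along the family `y` to functions on all
  -- solutions.
  have hH : Function.Injective H := by
    intro P Q hPQ
    refine MvPolynomial.funext fun x => ?_
    have := congrFun hPQ x
    simpa [H, MvPolynomial.aeval_eq_eval] using this
  have h1 : AlgebraicIndependent ℂ (fun i => ((eq' i : t) : MvPolynomial (Par o) ℂ)) :=
    hb.1.comp eq' eq'.injective
  have h2 : AlgebraicIndependent ℂ (H ∘ fun i => ((eq' i : t) : MvPolynomial (Par o) ℂ)) :=
    h1.map' hH
  refine AlgebraicIndependent.of_comp G ?_
  convert h2 using 1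
  funext i x
  simp only [Function.comp_apply, H, G, AlgHom.pi_apply, Pi.evalAlgHom_apply, coeffEntry, y]
  rw [coeff_shifted, ← hidx (eq' i)]
  simp

theorem conv_theta_sub_conv_theta {A : Type*} [Ring A] [Algebra ℂ A] (f : ℕ → A) (k : ℕ) :
    conv f (theta f) k - conv (theta f) f k =
      ∑ x ∈ antidiagonal k, (f x.1 * theta f x.2 - theta f x.2 * f x.1) := by
  rw [conv, conv, sum_sub_distrib, ← Finset.Nat.sum_antidiagonal_swap (n := k)
    (f := fun x => theta f x.1 * f x.2)]
  rfl

/-- The κ-term is a sum of commutators, so κ matters only through its action on them; this covers n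
= 1, where κ is not determined by the equation. -/
theorem defect_congr_kappa {A : Type*} [Ring A] [Algebra ℂ A] {κ κ' : ℂ}
    (h : ∀ y w : A, κ • (y * w - w * y) = κ' • (y * w - w * y)) (b c a : A) (f : ℕ → A) (k : ℕ) :
    defect κ b c a f k = defect κ' b c a f k := by
  rw [defect, defect, conv_theta_sub_conv_theta, smul_sum, smul_sum, sum_congr rfl fun x _ => h _ _]

theorem exists_eq_smul_one_of_forall_commute {n : ℕ} {x : Mat n} (h : ∀ y : Mat n, x * y = y * x) :
    ∃ m : ℂ, x = m • (1 : Mat n) := by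
  obtain ⟨m, hm⟩ := Matrix.mem_range_scalar_of_commute_single (M := x)
    (fun i j _ => (h (Matrix.single i j 1)).symm)
  exact ⟨m, by rw [← hm, Matrix.scalar_apply, Matrix.smul_one_eq_diagonal]⟩

theorem exists_add_sub_of_forall {n : ℕ} {b₁ b₂ b : Mat n}
    (h : ∀ y : Mat n, b₁ * y + y * b₂ = b * y + y * b) :
    ∃ m : ℂ, b₁ = b + m • (1 : Mat n) ∧ b₂ = b - m • (1 : Mat n) := by
  have h1 := h 1
  simp only [mul_one, one_mul] at h1
  have h2 : b₂ = b - (b₁ - b) := by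
    linear_combination (norm := abel) h1
  obtain ⟨m, hm⟩ := exists_eq_smul_one_of_forall_commute (x := b₁ - b) (fun y => by
    have := h y
    rw [h2, mul_sub] at this
    rw [sub_mul, sub_eq_iff_eq_add]
    linear_combination (norm := abel) this)
  exact ⟨m, by rw [← hm]; abel, by rw [← hm, ← h2]⟩

/-- The comparison of coefficients of two equations of the form considered. -/
theorem coefficients_of_shiftedRhs_eq {n : ℕ} {κ κ' β₁ β₂ : ℂ} {b₁ b₂ a b a' : Mat n}
    (h : ∀ (z : ℂ) (y w : Mat n), shiftedRhs κ b₁ b₂ a β₁ β₂ z y w =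
      κ' • (y * w - w * y) + (2 : ℂ) • y ^ 3 + z • y + b * y + y * b + a') :
    (∀ y w : Mat n, κ • (y * w - w * y) = κ' • (y * w - w * y)) ∧ a = a' ∧
      ∃ m : ℂ, b₁ = b + (m - β₁) • (1 : Mat n) ∧ b₂ = b - (m + β₂) • (1 : Mat n) := by
  have ha : a = a' := by simpa [shiftedRhs, rhs] using h 0 0 0
  have hb : ∀ y : Mat n, (b₁ + β₁ • (1 : Mat n)) * y + y * (b₂ + β₂ • (1 : Mat n)) =
      b * y + y * b := by
    intro y
    have := h 0 y 0
    simp only [shiftedRhs, rhs, ha, mul_zero, zero_mul, sub_zero, smul_zero, zero_smul] at this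
    linear_combination (norm := abel) this
  refine ⟨fun y w => ?_, ha, ?_⟩
  · have := h 0 y w
    simp only [shiftedRhs, rhs, ha, zero_mul, zero_smul] at this
    linear_combination (norm := abel) this - hb y
  · obtain ⟨m, h1, h2⟩ := exists_add_sub_of_forall hb
    refine ⟨m, ?_, ?_⟩
    · rw [sub_smul]; linear_combination (norm := abel) h1
    · rw [add_smul]; linear_combination (norm := abel) h2

theorem containsConstants_of_coefficients {n : ℕ} (o : Fin n) {ε κ : ℂ} {b c a : Mat n}
    (hε : ε = 1 ∨ ε = -1) (h : IsNormal κ b c a) {κ' z₀ m : ℂ} {b₁ b₂ a' : Mat n}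
    (hκ : ∀ y w : Mat n, κ' • (y * w - w * y) = (ε * κ) • (y * w - w * y))
    (ha : a' = ε • a) (hb : b₁ + z₀ • (1 : Mat n) = b + m • (1 : Mat n))
    (hc : b₂ = c - m • (1 : Mat n)) :
    ContainsConstants κ' b₁ b₂ a' z₀ (2 * n ^ 2 - 1) :=
  containsConstants_of_isNormal o hε h fun f k => by
    rw [defect_congr_kappa hκ, hb, hc, ha, defect_add_sub]

theorem passesTest_of_normalForm {n : ℕ} (hn : 1 ≤ n) {κ : ℂ} {b₁ b₂ a : Mat n} {β₁ β₂ : ℂ}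
    (h : IsP20 (shiftedRhs κ b₁ b₂ a β₁ β₂) ∨ IsP21 (shiftedRhs κ b₁ b₂ a β₁ β₂) ∨
      IsP22 (shiftedRhs κ b₁ b₂ a β₁ β₂)) : PassesTest κ b₁ b₂ a := by
  intro z₀
  have o : Fin n := ⟨0, hn⟩
  rcases h with ⟨α, b, h⟩ | ⟨ε, a', hε, h⟩ | ⟨ε, a', b, hε, hab, h⟩
  · obtain ⟨h1, rfl, m, rfl, rfl⟩ := coefficients_of_shiftedRhs_eq (κ' := 0)
      (a' := α • (1 : Mat n)) (b := b) (fun z y w => by rw [h, zero_smul, zero_add])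
    -- The total scalar is split evenly so that b = c; this is possible because only the sum of the
    -- scalar parts of b₁ and b₂ matters.
    set t := (z₀ - β₁ - β₂) / 2 with ht
    refine containsConstants_of_coefficients o (Or.inl rfl) (κ := 0) (b := b + t • (1 : Mat n))
      (c := b + t • (1 : Mat n)) (a := α • (1 : Mat n)) (m := m - β₁ + z₀ - t)
      (Or.inl ⟨rfl, rfl, α, rfl⟩) (by simpa using h1) (one_smul _ _).symm (by module) ?_
    rw [show m + β₂ = m - β₁ + z₀ - t - t by rw [ht]; ring]
    module
  · obtain ⟨h1, rfl, m, rfl, rfl⟩ := coefficients_of_shiftedRhs_eq (κ' := ε)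
      (a' := a') (b := 0) (fun z y w => by rw [h]; simp)
    refine containsConstants_of_coefficients o hε (κ := 1) (b := 0)
      (c := (z₀ - β₁ - β₂) • (1 : Mat n)) (a := ε • a) (m := m - β₁ + z₀)
      (Or.inr (Or.inl ⟨rfl, rfl, _, rfl⟩)) (by simpa using h1) ?_ (by module) (by module)
    rcases hε with rfl | rfl <;> simp
  · obtain ⟨h1, rfl, m, rfl, rfl⟩ := coefficients_of_shiftedRhs_eq h
    set t := (z₀ - β₁ - β₂) / 2 with ht
    have hεε : ε * ε = 1 := by rcases hε with rfl | rfl <;> norm_num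
    refine containsConstants_of_coefficients o hε (κ := 2) (b := b + t • (1 : Mat n))
      (c := b + t • (1 : Mat n)) (a := ε • a) (m := m - β₁ + z₀ - t)
      (Or.inr (Or.inr ⟨rfl, rfl, -(2 * t), ?_⟩)) h1 ?_ (by module) ?_
    · have h2 : b * (ε • a) - ε • a * b = (2 : ℂ) • b := by
        rw [mul_smul_comm, smul_mul_assoc, ← smul_sub, hab, smul_smul, ← mul_assoc, hεε, one_mul]
      simp only [add_mul, mul_add, smul_mul_assoc, mul_smul_comm, one_mul, mul_one] at h2 ⊢
      linear_combination (norm := module) h2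
    · rw [smul_smul, hεε, one_smul]
    · rw [show m + β₂ = m - β₁ + z₀ - t - t by rw [ht]; ring]
      module

/-! ### Derivations of fields and generic points -/

section Derivations

open scoped TensorProduct

/-- In characteristic zero, algebraically independent elements of a field admit derivations with
arbitrary values. -/
theorem exists_derivation_apply_eq {F K : Type*} [Field F] [CharZero F] [Field K] [Algebra F K]
    {ι : Type*} {e : ι → K}
    (he : AlgebraicIndependent F e) (g : ι → K) :
    ∃ D : Derivation F K K, ∀ i, D (e i) = g i := by
  classical
  obtain ⟨t, het, ht⟩ := exists_isTranscendenceBasis_superset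
    (algebraicIndependent_subtype_range he.injective |>.2 he)
  let x : t → K := (↑)
  let : Algebra (MvPolynomial t F) K := (MvPolynomial.aeval x).toRingHom.toAlgebra
  have hmap : ∀ q : MvPolynomial t F, algebraMap (MvPolynomial t F) K q = MvPolynomial.aeval x q :=
    fun q => rfl
  have : IsScalarTower F (MvPolynomial t F) K := IsScalarTower.of_algebraMap_eq fun r => by
    rw [hmap, MvPolynomial.algebraMap_eq, MvPolynomial.aeval_C]
  have : FaithfulSMul (MvPolynomial t F) K :=
    (faithfulSMul_iff_algebraMap_injective _ _).2 ht.1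
  let := FractionRing.liftAlgebra (MvPolynomial t F) K
  have := FractionRing.isScalarTower_liftAlgebra (MvPolynomial t F) K
  have : Algebra.IsAlgebraic (MvPolynomial t F) K := by
    have := ht.isAlgebraic
    refine Algebra.IsAlgebraic.ringHom_of_comp_eq ht.1.aevalEquiv.symm (RingHom.id K)
      ht.1.aevalEquiv.symm.injective Function.surjective_id (RingHom.ext fun z => ?_)
    obtain ⟨q, rfl⟩ := ht.1.aevalEquiv.surjective z
    simp only [RingHom.comp_apply, RingHom.coe_coe, AlgEquiv.symm_apply_apply, hmap,
      RingHom.id_apply]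
    exact (ht.1.algebraMap_aevalEquiv q).symm
  have : Algebra.IsAlgebraic (FractionRing (MvPolynomial t F)) K :=
    Algebra.IsAlgebraic.extendScalars (IsFractionRing.injective (MvPolynomial t F) _)
  have : CharZero (FractionRing (MvPolynomial t F)) :=
    charZero_of_injective_algebraMap (algebraMap F _).injective
  have : Algebra.FormallyEtale (FractionRing (MvPolynomial t F)) K :=
    Algebra.FormallyEtale.of_isSeparable _ _
  have : Algebra.FormallyEtale (MvPolynomial t F) (FractionRing (MvPolynomial t F)) :=
    Algebra.FormallyEtale.of_isLocalization (nonZeroDivisors _)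
  have : Algebra.FormallyEtale (MvPolynomial t F) K :=
    Algebra.FormallyEtale.comp _ (FractionRing (MvPolynomial t F)) _
  let d : Derivation F (MvPolynomial t F) K := MvPolynomial.mkDerivation F fun u =>
    -- The derivation is zero on the basis elements outside `e`. It extends to K because K is
    -- algebraic, hence separable, over the rational function field.
    if h : ∃ i, e i = u then g h.choose else 0
  let l : Ω[K⁄F] →ₗ[K] K := d.liftKaehlerDifferential.liftBaseChange K ∘ₗ
    (KaehlerDifferential.tensorKaehlerEquivOfFormallyEtale F (MvPolynomial t F) K).symm.toLinearMap
  refine ⟨l.compDer (KaehlerDifferential.D F K), fun i => ?_⟩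
  have hl : ∀ q, l (KaehlerDifferential.D F K (MvPolynomial.aeval x q)) = d q := fun q => by
    simp only [← hmap, l, LinearMap.comp_apply, LinearEquiv.coe_coe,
      KaehlerDifferential.tensorKaehlerEquivOfFormallyEtale_symm_D_algebraMap,
      LinearMap.liftBaseChange_tmul, one_smul, Derivation.liftKaehlerDifferential_comp_D]
  have h1 := hl (MvPolynomial.X ⟨e i, het ⟨i, rfl⟩⟩)
  rw [MvPolynomial.aeval_X] at h1
  have h2 : ∃ j, e j = e i := ⟨i, rfl⟩
  refine h1.trans ?_
  simp only [d, MvPolynomial.mkDerivation_X]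
  rw [dif_pos h2, he.injective h2.choose_spec]

/-- Algebraically independent elements of an algebra stay algebraically independent in the
fraction field of a suitable integral quotient. -/
theorem exists_field_algebraicIndependent {F T : Type} [Field F] [CommRing T] [Algebra F T]
    {ι : Type*} {e : ι → T} (he : AlgebraicIndependent F e) :
    ∃ (K : Type) (_ : Field K) (_ : Algebra F K) (φ : T →ₐ[F] K),
      AlgebraicIndependent F fun i => φ (e i) := by
  let M : Submonoid T := (nonZeroDivisors (MvPolynomial ι F)).map (MvPolynomial.aeval (R := F) e)
  -- Independence says that no nonzero polynomial in the `e i` is zero; a prime ideal avoiding these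
  -- values keeps them nonzero in the quotient.
  have hM : Disjoint ((⊥ : Ideal T) : Set T) M := by
    rw [Set.disjoint_left]
    rintro y hy ⟨Q, hQ, rfl⟩
    refine nonZeroDivisors.ne_zero hQ (he ?_)
    rw [map_zero]
    exact hy
  obtain ⟨P, hP, -, hPM⟩ := Ideal.exists_le_prime_disjoint _ _ hM
  let φ : T →ₐ[F] FractionRing (T ⧸ P) :=
    (IsScalarTower.toAlgHom F (T ⧸ P) (FractionRing (T ⧸ P))).comp (Ideal.Quotient.mkₐ F P)
  refine ⟨FractionRing (T ⧸ P), inferInstance, inferInstance, φ, ?_⟩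
  rw [algebraicIndependent_iff]
  intro Q hQ
  rw [← MvPolynomial.comp_aeval, AlgHom.comp_apply] at hQ
  by_contra hQ0
  have h1 : Ideal.Quotient.mk P (MvPolynomial.aeval e Q) = 0 := by
    refine IsFractionRing.injective (T ⧸ P) (FractionRing (T ⧸ P)) ?_
    rw [map_zero]
    exact hQ
  rw [Ideal.Quotient.eq_zero_iff_mem] at h1
  exact Set.disjoint_left.1 hPM h1 ⟨Q, mem_nonZeroDivisors_of_ne_zero hQ0, rfl⟩

end Derivations

/-! ### Variations of a solution -/

section Linearization

variable {A : Type*} [Ring A]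

theorem conv_eq_mul_zero {u g : ℕ → A} {k : ℕ} (h : ∀ i < k, u i = 0) :
    conv u g k = u k * g 0 := by
  rw [conv, sum_eq_single (k, 0)]
  · rintro ⟨i, l⟩ hx hne
    rw [HasAntidiagonal.mem_antidiagonal] at hx
    simp only at hx ⊢
    rw [h i, zero_mul]
    refine lt_of_le_of_ne (by omega) fun h' => hne ?_
    ext <;> simp <;> omega
  · simp

theorem conv_eq_zero_mul {u g : ℕ → A} {k : ℕ} (h : ∀ i < k, u i = 0) :
    conv g u k = g 0 * u k := by
  rw [conv, sum_eq_single (0, k)]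
  · rintro ⟨i, l⟩ hx hne
    rw [HasAntidiagonal.mem_antidiagonal] at hx
    simp only at hx ⊢
    rw [h l, mul_zero]
    refine lt_of_le_of_ne (by omega) fun h' => hne ?_
    ext <;> simp <;> omega
  · simp

variable [Algebra ℂ A]

theorem leibniz_conv {d : A →ₗ[ℂ] A} (hd : ∀ x y, d (x * y) = d x * y + x * d y) (f g : ℕ → A)
    (k : ℕ) : d (conv f g k) = conv (fun i => d (f i)) g k + conv f (fun i => d (g i)) k := by
  simp only [conv, map_sum, hd, sum_add_distrib]

/-- The lowest coefficient of a variation of a solution is annihilated by the resonance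
operator. -/
theorem resOp_derivation_eq_zero {d : A →ₗ[ℂ] A} (hd : ∀ x y, d (x * y) = d x * y + x * d y)
    {κ : ℂ} {b c a : A} (hb : d b = 0) (hc : d c = 0) (ha : d a = 0) {f : ℕ → A} {k : ℕ}
    (hf : defect κ b c a f k = 0) (h : ∀ i < k, d (f i) = 0) : resOp κ (f 0) k (d (f k)) = 0 := by
  have ht : (fun i => d (theta f i)) = theta fun i => d (f i) := by
    funext i; simp [theta]
  have ht0 : ∀ i < k, theta (fun i => d (f i)) i = 0 := fun i hi => by
    rw [theta, h i hi, smul_zero]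
  have hcc : ∀ i < k, d (conv f f i) = 0 := fun i hi => by
    rw [leibniz_conv hd, conv_eq_mul_zero fun l hl => h l (by omega),
      conv_eq_zero_mul fun l hl => h l (by omega), h i hi, zero_mul, mul_zero, add_zero]
  have h4 : d (if 2 ≤ k then b * f (k - 2) + f (k - 2) * c else 0) = 0 := by
    split_ifs with h'
    · rw [map_add, hd, hd, hb, hc, h (k - 2) (by omega)]
      simp
    · exact map_zero d
  have h5 : d (if 3 ≤ k then f (k - 3) else 0) = 0 := by
    split_ifs with h'
    · exact h _ (by omega)
    · exact map_zero d
  have h6 : d (if k = 3 then a else 0) = 0 := by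
    split_ifs
    exacts [ha, map_zero d]
  have := congrArg d hf
  rw [defect, map_sub, map_sub, map_sub, map_sub, map_sub, h4, h5, h6, map_smul, map_smul,
    map_smul, map_sub, leibniz_conv hd, leibniz_conv hd, leibniz_conv hd, ht,
    conv_eq_mul_zero h, conv_eq_zero_mul ht0, conv_eq_mul_zero ht0, conv_eq_zero_mul h,
    conv_eq_mul_zero hcc, conv_eq_zero_mul h, leibniz_conv hd, conv_eq_mul_zero h,
    conv_eq_zero_mul h, map_zero] at this
  rw [← this, resOp]
  simp only [theta, conv, Finset.Nat.antidiagonal_zero, sum_singleton, add_mul, mul_smul_comm,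
    smul_mul_assoc, mul_assoc]
  push_cast
  module

end Linearization

/-! ### A generic solution over a field -/

section GenericSolution

/-- A derivation acting on matrices entry by entry. -/
def matDer {n : ℕ} {K : Type*} [CommRing K] [Algebra ℂ K] (D : Derivation ℂ K K) :
    Matrix (Fin n) (Fin n) K →ₗ[ℂ] Matrix (Fin n) (Fin n) K :=
  (D : K →ₗ[ℂ] K).mapMatrix

variable {n : ℕ} {K : Type*} [CommRing K] [Algebra ℂ K] (D : Derivation ℂ K K)

theorem matDer_apply (x : Matrix (Fin n) (Fin n) K) (r s : Fin n) :
    matDer D x r s = D (x r s) := rfl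

theorem matDer_mul (x y : Matrix (Fin n) (Fin n) K) :
    matDer D (x * y) = matDer D x * y + x * matDer D y := by
  ext r s
  simp only [matDer_apply, Matrix.mul_apply, Matrix.add_apply, map_sum, Derivation.leibniz,
    smul_eq_mul, ← sum_add_distrib]
  exact sum_congr rfl fun i _ => by ring

theorem matDer_map_algebraMap (b : Mat n) :
    matDer D ((Algebra.ofId ℂ K).mapMatrix b) = 0 := by
  ext r s
  exact D.map_algebraMap _

/-- If the test is passed, there is a solution over a field, all of whose generic parameters are
algebraically independent. -/
theorem exists_generic_solution {n : ℕ} {κ : ℂ} {b c a : Mat n} {N : ℕ}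
    (h : ContainsConstants κ b c a 0 N) :
    ∃ (K : Type) (_ : Field K) (_ : Algebra ℂ K) (f : ℕ → Matrix (Fin n) (Fin n) K)
      (u : Fin N → K), AlgebraicIndependent ℂ u ∧
      (∀ i, u i = 0 ∨ ∃ k r s, u i = f k r s) ∧ f 0 ≠ 0 ∧
      ∀ k, defect κ ((Algebra.ofId ℂ K).mapMatrix b) ((Algebra.ofId ℂ K).mapMatrix c)
        ((Algebra.ofId ℂ K).mapMatrix a) f k = 0 := by
  classical
  obtain ⟨e, he⟩ := h
  obtain ⟨K, _, _, φ, hφ⟩ := exists_field_algebraicIndependent he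
  let F : ℕ → Matrix (Fin n) (Fin n) (PolarSolution κ b c a 0 → ℂ) := fun k =>
    Matrix.of fun r s => coeffEntry κ b c a 0 (-1 + k, r, s)
  have hF : ∀ k, defect κ ((Algebra.ofId ℂ _).mapMatrix b) ((Algebra.ofId ℂ _).mapMatrix c)
      ((Algebra.ofId ℂ _).mapMatrix a) F k = 0 := by
    intro k
    ext r s y
    have h1 := map_defect ((Pi.evalAlgHom ℂ (fun _ : PolarSolution κ b c a 0 => ℂ) y).mapMatrix
      (m := Fin n)) κ ((Algebra.ofId ℂ _).mapMatrix b) ((Algebra.ofId ℂ _).mapMatrix c)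
      ((Algebra.ofId ℂ _).mapMatrix a) F k
    have h2 := y.2.defect_eq_zero k
    rw [zero_smul, add_zero] at h2
    exact (congrFun (congrFun (h1.trans h2) r) s)
  have hne : ∀ y : PolarSolution κ b c a 0, ∃ x : Fin n × Fin n, y.1.coeff (-1) x.1 x.2 ≠ 0 := by
    intro y
    by_contra! hy
    exact y.2.residue_ne_zero (Matrix.ext fun r s => hy (r, s))
  choose x hx using hne
  -- Every residue has a nonzero entry, so the residue entries generate the unit ideal of the ring
  -- of functions. Hence they cannot all become zero in K.
  let W : Fin n × Fin n → PolarSolution κ b c a 0 → ℂ := fun t y =>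
    if t = x y then (y.1.coeff (-1) t.1 t.2)⁻¹ else 0
  have hW : ∑ t, W t * F 0 t.1 t.2 = 1 := by
    funext y
    rw [Finset.sum_apply, sum_eq_single (x y)]
    · simp only [Pi.mul_apply, W, if_pos]
      exact inv_mul_cancel₀ (hx y)
    · intro t _ ht
      simp [W, ht]
    · simp
  refine ⟨K, inferInstance, inferInstance, fun k => φ.mapMatrix (F k), fun i => φ _, hφ,
    fun i => ?_, fun h0 => ?_, fun k => ?_⟩
  · by_cases hi : (e i).1 < -1
    · left
      convert map_zero φ
      funext y
      simp [coeffEntry, y.2.coeff_eq_zero _ hi]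
    · right
      refine ⟨((e i).1 + 1).toNat, (e i).2.1, (e i).2.2, ?_⟩
      simp only [AlgHom.mapMatrix_apply, Matrix.map_apply, F, Matrix.of_apply]
      congr 2
      ext1
      · simp only; omega
      · rfl
  · have := congrArg φ hW
    rw [map_sum, map_one] at this
    refine one_ne_zero (this.symm.trans (sum_eq_zero fun t _ => ?_))
    have ht : φ (F 0 t.1 t.2) = 0 := congrFun (congrFun h0 t.1) t.2
    rw [map_mul, ht, mul_zero]
  · have h1 := map_defect φ.mapMatrix κ ((Algebra.ofId ℂ _).mapMatrix b)
      ((Algebra.ofId ℂ _).mapMatrix c) ((Algebra.ofId ℂ _).mapMatrix a) F k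
    rw [hF, map_zero] at h1
    have h2 (m : Mat n) : φ.mapMatrix ((Algebra.ofId ℂ _).mapMatrix m) =
        (Algebra.ofId ℂ K).mapMatrix m := by
      ext r s
      exact φ.commutes _
    simp only [h2] at h1
    exact h1.symm

end GenericSolution

/-! ### Diagonalization of the residue -/

section Diagonalization

/-- A matrix with `p³ = p` is diagonalizable, with eigenvalues `0, 1, -1`. -/
theorem exists_diagonalization {n : ℕ} {K : Type*} [Field K] [Algebra ℂ K]
    {p : Matrix (Fin n) (Fin n) K} (hp : p * p * p = p) :
    ∃ (σ : Fin n → ℂ) (g g' : Matrix (Fin n) (Fin n) K), (∀ i, σ i = 0 ∨ σ i = 1 ∨ σ i = -1) ∧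
      g * g' = 1 ∧ g' * g = 1 ∧ p = g * Matrix.diagonal (fun i => algebraMap ℂ K (σ i)) * g' := by
  have : CharZero K := charZero_of_injective_algebraMap (algebraMap ℂ K).injective
  let s : Set (Fin n → K) :=
    {v | ∃ m : ℂ, (m = 0 ∨ m = 1 ∨ m = -1) ∧ p.mulVec v = algebraMap ℂ K m • v}
  have hs : ⊤ ≤ Submodule.span K s := by
    intro v _
    have h3 : p.mulVec (p.mulVec (p.mulVec v)) = p.mulVec v := by
      rw [Matrix.mulVec_mulVec, Matrix.mulVec_mulVec, hp]
    have h0 : v - p.mulVec (p.mulVec v) ∈ s := ⟨0, Or.inl rfl, by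
      rw [Matrix.mulVec_sub, h3, sub_self, map_zero, zero_smul]⟩
    have h1 : p.mulVec (p.mulVec v) + p.mulVec v ∈ s := ⟨1, Or.inr (Or.inl rfl), by
      rw [Matrix.mulVec_add, h3, map_one, one_smul, add_comm]⟩
    have h2 : p.mulVec (p.mulVec v) - p.mulVec v ∈ s := ⟨-1, Or.inr (Or.inr rfl), by
      rw [Matrix.mulVec_sub, h3, map_neg, map_one, neg_smul, one_smul, neg_sub]⟩
    -- The spectral projectors of p³ = p are 1 - p² and (p² ± p)/2.
    have hv : v = (v - p.mulVec (p.mulVec v)) + ((2 : K)⁻¹ • (p.mulVec (p.mulVec v) + p.mulVec v) +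
        (2 : K)⁻¹ • (p.mulVec (p.mulVec v) - p.mulVec v)) := by
      rw [← smul_add, add_add_sub_cancel, ← two_smul K, smul_smul, inv_mul_cancel₀ two_ne_zero,
        one_smul, sub_add_cancel]
    rw [hv]
    exact add_mem (Submodule.subset_span h0) (add_mem
      (Submodule.smul_mem _ _ (Submodule.subset_span h1))
      (Submodule.smul_mem _ _ (Submodule.subset_span h2)))
  let B := Module.Basis.ofSpan hs
  let B' : Module.Basis (Fin n) K (Fin n → K) := B.reindex (B.indexEquiv (Pi.basisFun K (Fin n)))
  have hB : ∀ i, B' i ∈ s := fun i => by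
    rw [Module.Basis.reindex_apply]
    exact Module.Basis.ofSpan_subset hs ⟨_, rfl⟩
  choose σ hσ hσ' using hB
  refine ⟨σ, (Pi.basisFun K (Fin n)).toMatrix B', B'.toMatrix (Pi.basisFun K (Fin n)), hσ,
    Module.Basis.toMatrix_mul_toMatrix_flip _ _, Module.Basis.toMatrix_mul_toMatrix_flip _ _, ?_⟩
  have : p * (Pi.basisFun K (Fin n)).toMatrix B' =
      (Pi.basisFun K (Fin n)).toMatrix B' * Matrix.diagonal fun i => algebraMap ℂ K (σ i) := by
    ext r i
    rw [Matrix.mul_diagonal]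
    have := congrFun (hσ' i) r
    rw [Pi.smul_apply, smul_eq_mul, mul_comm] at this
    exact this
  rw [← this, mul_assoc, Module.Basis.toMatrix_mul_toMatrix_flip, mul_one]

end Diagonalization

/-! ### Counting resonances -/

section Resonances

theorem resEig_sub (κ : ℂ) (k k' : ℕ) (l m : ℂ) :
    resEig κ k l m - resEig κ k' l m = ((k : ℂ) - k') * (k + k' - 3 - κ * (l - m)) := by
  simp only [resEig]; ring

/-- At a pair of eigenvalues of the residue there are at most two resonances. -/
theorem exists_finset_resEig (κ l m : ℂ) :
    ∃ F : Finset ℕ, F.card ≤ 2 ∧ ∀ k, k ∈ F ↔ resEig κ k l m = 0 := by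
  classical
  by_cases h : ∃ k, resEig κ k l m = 0
  swap
  · push Not at h
    exact ⟨∅, by simp, fun k => by simp [h k]⟩
  obtain ⟨k₁, h₁⟩ := h
  by_cases h : ∃ k, resEig κ k l m = 0 ∧ k ≠ k₁
  swap
  · push Not at h
    exact ⟨{k₁}, by simp, fun k => ⟨fun hk => by rw [mem_singleton.1 hk, h₁],
      fun hk => mem_singleton.2 (h k hk)⟩⟩
  obtain ⟨k₂, h₂, h₁₂⟩ := h
  refine ⟨{k₁, k₂}, card_le_two, fun k => ⟨fun hk => ?_, fun hk => ?_⟩⟩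
  · rw [mem_insert, mem_singleton] at hk
    rcases hk with rfl | rfl <;> assumption
  · rw [mem_insert, mem_singleton]
    by_contra! hne
    have h3 := resEig_sub κ k₂ k₁ l m
    have h4 := resEig_sub κ k k₁ l m
    rw [h₁, h₂, sub_zero, eq_comm, mul_eq_zero, or_iff_right
      (sub_ne_zero.2 (by exact_mod_cast h₁₂))] at h3
    rw [h₁, hk, sub_zero, eq_comm, mul_eq_zero, or_iff_right
      (sub_ne_zero.2 (by exact_mod_cast hne.1))] at h4
    exact hne.2 (by exact_mod_cast (by linear_combination h4 - h3 : (k : ℂ) = k₂))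

theorem resEig_self_eq_zero {κ : ℂ} {k : ℕ} {l : ℂ} (hl : l = 1 ∨ l = -1)
    (h : resEig κ k l l = 0) : k = 4 :=
  resEig_one_one_eq_zero (κ := κ) (by
    rw [← h]
    rcases hl with rfl | rfl
    · rfl
    · simp only [resEig]; ring)

/-- Two resonances between the eigenvalues `±1` and `0`. -/
theorem exists_cast_eq_of_two_le_card {l : ℂ} {F : Finset ℕ} (h2 : 2 ≤ F.card)
    (h : ∀ k ∈ F, ((k : ℂ)) * (k - 3 - l) = 0) : ∃ k : ℕ, 1 ≤ k ∧ (k : ℂ) = 3 + l := by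
  obtain ⟨i, hi, j, hj, hij⟩ := one_lt_card.1 h2
  have (k : ℕ) (hk : k ∈ F) (h0 : k ≠ 0) : (k : ℂ) = 3 + l := by
    have := (mul_eq_zero.1 (h k hk)).resolve_left (by exact_mod_cast h0)
    linear_combination this
  rcases eq_or_ne i 0 with rfl | h0
  · exact ⟨j, Nat.one_le_iff_ne_zero.2 hij.symm, this j hj hij.symm⟩
  · exact ⟨i, Nat.one_le_iff_ne_zero.2 h0, this i hi h0⟩

/-- The total deficit from 2 is at most 1, and `x₀` already uses it. -/
theorem sum_eq_and_eq_two {ι : Type*} [Fintype ι] [DecidableEq ι] {c : ι → ℕ} (hc : ∀ x, c x ≤ 2)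
    {x₀ : ι} (h₀ : c x₀ ≤ 1) (h : 2 * Fintype.card ι - 1 ≤ ∑ x, c x) :
    ∑ x, c x = 2 * Fintype.card ι - 1 ∧ ∀ x ≠ x₀, c x = 2 := by
  have h1 : ∑ x, c x + ∑ x, (2 - c x) = 2 * Fintype.card ι := by
    rw [← sum_add_distrib, sum_congr rfl fun x _ => Nat.add_sub_of_le (hc x)]
    simp [mul_comm]
  have h2 : 2 - c x₀ ≤ ∑ x, (2 - c x) := single_le_sum (f := fun x => 2 - c x)
    (fun _ _ => Nat.zero_le _) (mem_univ x₀)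
  refine ⟨by omega, fun x hx => ?_⟩
  have h3 : (2 - c x₀) + (2 - c x) ≤ ∑ x, (2 - c x) := by
    rw [← sum_pair (f := fun x => 2 - c x) hx.symm]
    exact sum_le_sum_of_subset (subset_univ _)
  have := hc x
  omega

end Resonances

/-! ### Full solutions: every admissible variation is realized -/

section Full

variable {n : ℕ} {K : Type} [Field K] [Algebra ℂ K]

/-- A solution with nonzero residue of rank one, every variation of whose coefficients that is
compatible with the resonance operator comes from a derivation of the field. -/
structure IsFullSolution (κ : ℂ) (b c a : Mat n) (f : ℕ → Matrix (Fin n) (Fin n) K) : Prop where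
  defect_eq_zero : ∀ k, defect κ ((Algebra.ofId ℂ K).mapMatrix b) ((Algebra.ofId ℂ K).mapMatrix c)
    ((Algebra.ofId ℂ K).mapMatrix a) f k = 0
  ne_zero : f 0 ≠ 0
  rank_one : ∀ x, ∃ τ : K, f 0 * x * f 0 = τ • f 0
  exists_derivation : ∀ (J : ℕ) (w : Matrix (Fin n) (Fin n) K), resOp κ (f 0) J w = 0 →
    ∃ D : Derivation ℂ K K, (∀ k < J, matDer D (f k) = 0) ∧ matDer D (f J) = w

theorem conj_resOp {A : Type*} [Ring A] [Algebra ℂ A] {g g' : A} (hg' : g' * g = 1)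
    (κ : ℂ) (p : A) (k : ℕ) (w : A) :
    g' * resOp κ (g * p * g') k w * g = resOp κ p k (g' * w * g) := by
  have h1 (x : A) : g' * (g * x) = x := by rw [← mul_assoc, hg', one_mul]
  simp only [resOp, mul_sub, sub_mul, mul_add, add_mul, mul_smul_comm, smul_mul_assoc, mul_assoc,
    h1, hg', mul_one]

/-- The variations of a solution by derivations, read off at the resonances. -/
def variation (f : ℕ → Matrix (Fin n) (Fin n) K) (g g' : Matrix (Fin n) (Fin n) K) (ι : Type*)
    (e : ι → Fin n × Fin n × ℕ) : Derivation ℂ K K →ₗ[K] (ι → K) where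
  toFun D t := (g' * matDer D (f (e t).2.2) * g) (e t).1 (e t).2.1
  map_add' D D' := by
    funext t
    have : matDer (D + D') (f (e t).2.2) = matDer D (f (e t).2.2) + matDer D' (f (e t).2.2) := rfl
    rw [this, mul_add, add_mul]
    rfl
  map_smul' x D := by
    funext t
    have : matDer (x • D) (f (e t).2.2) = x • matDer D (f (e t).2.2) := rfl
    rw [this, mul_smul_comm, smul_mul_assoc]
    rfl

/-- The derivations dual to the constants have independent variations, read off at the resonances.
There are no more than 2n² - 1 of those, so equality holds in the count: this fixes the spectrum of
the residue and makes the variation map surjective. -/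
theorem IsFullSolution.of_algebraicIndependent (hn : 2 ≤ n) {κ : ℂ} {b c a : Mat n}
    {f : ℕ → Matrix (Fin n) (Fin n) K}
    (hf : ∀ k, defect κ ((Algebra.ofId ℂ K).mapMatrix b) ((Algebra.ofId ℂ K).mapMatrix c)
      ((Algebra.ofId ℂ K).mapMatrix a) f k = 0) (h0 : f 0 ≠ 0) {u : Fin (2 * n ^ 2 - 1) → K}
    (hu : AlgebraicIndependent ℂ u) (huf : ∀ i, u i = 0 ∨ ∃ k r s, u i = f k r s) :
    IsFullSolution κ b c a f ∧ (∃ ε : ℂ, (ε = 1 ∨ ε = -1) ∧ f 0 * f 0 = ε • f 0) ∧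
      (∃ k : ℕ, 1 ≤ k ∧ (k : ℂ) = 3 + κ) ∧ ∃ k : ℕ, 1 ≤ k ∧ (k : ℂ) = 3 - κ := by
  classical
  have hp : f 0 * f 0 * f 0 = f 0 := by
    have := hf 0
    rw [defect_zero, smul_eq_zero, or_iff_right two_ne_zero, sub_eq_zero] at this
    exact this.symm
  obtain ⟨σ, g, g', hσ, hg, hg', hpσ⟩ := exists_diagonalization hp
  choose R hR2 hR using fun x : Fin n × Fin n => exists_finset_resEig κ (σ x.1) (σ x.2)
  let ι := Σ x : Fin n × Fin n, R x
  let e : ι → Fin n × Fin n × ℕ := fun t => (t.1.1, t.1.2, t.2)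
  have hdiag (k : ℕ) (w : Matrix (Fin n) (Fin n) K) (r s : Fin n) :
      (g' * resOp κ (f 0) k w * g) r s = resEig κ k (σ r) (σ s) • (g' * w * g) r s := by
    rw [hpσ, conj_resOp hg', resOp_diagonal_apply]
  have hback (w : Matrix (Fin n) (Fin n) K) : g * (g' * w * g) * g' = w := by
    rw [show g * (g' * w * g) * g' = (g * g') * w * (g * g') by noncomm_ring, hg, one_mul, mul_one]
  have hsupp (k : ℕ) (w : Matrix (Fin n) (Fin n) K) (hw : resOp κ (f 0) k w = 0) (r s : Fin n)
      (hk : k ∉ R (r, s)) : (g' * w * g) r s = 0 := by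
    have := hdiag k w r s
    rw [hw, mul_zero, zero_mul, Matrix.zero_apply, eq_comm, smul_eq_zero] at this
    exact this.resolve_left fun h => hk ((hR (r, s) k).2 h)
  have hlow (D : Derivation ℂ K K) (k : ℕ) (h : ∀ i < k, matDer D (f i) = 0) :
      resOp κ (f 0) k (matDer D (f k)) = 0 :=
    resOp_derivation_eq_zero (matDer_mul D) (matDer_map_algebraMap D b) (matDer_map_algebraMap D c)
      (matDer_map_algebraMap D a) (hf k) h
  let Ψ := variation f g g' ι e
  have hΨ (D : Derivation ℂ K K) (r s : Fin n) (k : ℕ) (hk : k ∈ R (r, s)) :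
      Ψ D ⟨(r, s), k, hk⟩ = (g' * matDer D (f k) * g) r s := rfl
  -- The lowest nonzero variation lies in the kernel of the resonance operator, so it must be
  -- visible at a resonance.
  have hvanish (D : Derivation ℂ K K) (J : ℕ)
      (h : ∀ r s k (hk : k ∈ R (r, s)), k < J → Ψ D ⟨(r, s), k, hk⟩ = 0) :
      ∀ k < J, matDer D (f k) = 0 := by
    intro k
    induction k using Nat.strong_induction_on with
    | _ k ih =>
      intro hkJ
      have h1 := hlow D k fun i hi => ih i hi (hi.trans hkJ)
      rw [← hback (matDer D (f k))]
      have : g' * matDer D (f k) * g = 0 := by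
        ext r s
        by_cases hk : k ∈ R (r, s)
        · exact h r s k hk hkJ
        · exact hsupp k _ h1 r s hk
      rw [this, mul_zero, zero_mul]
  choose D hD using fun i => exists_derivation_apply_eq hu (Pi.single i (1 : K))
  have hli : LinearIndependent K fun i => Ψ (D i) := by
    rw [Fintype.linearIndependent_iff]
    intro x hx j
    have h1 : Ψ (∑ i, x i • D i) = 0 := by
      rw [map_sum, ← hx]
      exact sum_congr rfl fun i _ => map_smul _ _ _
    have h2 : ∀ k, matDer (∑ i, x i • D i) (f k) = 0 := fun k =>
      hvanish _ (k + 1) (fun r s i hi _ => by rw [h1]; rfl) k k.lt_succ_self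
    have h3 : (∑ i, x i • D i) (u j) = 0 := by
      rcases huf j with h | ⟨k, r, s, h⟩
      · rw [h, map_zero]
      · rw [h]
        exact congrFun (congrFun (h2 k) r) s
    have h4 : (∑ i, x i • D i) (u j) = ∑ i, x i * D i (u j) := by
      rw [← Derivation.coeFnAddMonoidHom_apply, map_sum, Finset.sum_apply]
      rfl
    rw [h4, sum_eq_single j, hD, Pi.single_eq_same, mul_one] at h3
    · exact h3
    · intro i _ hij
      rw [hD, Pi.single_eq_of_ne hij.symm, mul_zero]
    · simp
  obtain ⟨o, ho⟩ : ∃ o, σ o ≠ 0 := by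
    by_contra! h
    refine h0 ?_
    rw [hpσ]
    simp [h]
  -- The roots are 4 and -1, and -1 is not a natural number; it corresponds to moving the pole.
  have hone (r : Fin n) (h : σ r ≠ 0) : (R (r, r)).card ≤ 1 :=
    card_le_one.2 fun i hi j hj => by
      rw [resEig_self_eq_zero ((hσ r).resolve_left h) ((hR (r, r) i).1 hi),
        resEig_self_eq_zero ((hσ r).resolve_left h) ((hR (r, r) j).1 hj)]
  have hcard : Fintype.card ι = ∑ x, (R x).card := by
    simp only [ι, Fintype.card_sigma, Fintype.card_coe]
  have hnn : n ^ 2 = Fintype.card (Fin n × Fin n) := by simp [sq]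
  obtain ⟨hsum, htwo⟩ := sum_eq_and_eq_two hR2 (hone o ho) (by
    rw [← hcard, ← hnn]
    simpa using hli.fintype_card_le_finrank)
  have hzero (r : Fin n) (hr : r ≠ o) : σ r = 0 := by
    by_contra h
    have h1 := hone r h
    rw [htwo (r, r) (by simp [hr])] at h1
    omega
  have hspan : Submodule.span K (Set.range fun i => Ψ (D i)) = ⊤ :=
    hli.span_eq_top_of_card_eq_finrank' (by
      rw [Module.finrank_fintype_fun_eq_card, hcard, hsum, ← hnn, Fintype.card_fin])
  have hsurj : Function.Surjective Ψ := by
    rw [← LinearMap.range_eq_top, eq_top_iff, ← hspan, Submodule.span_le]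
    rintro _ ⟨i, rfl⟩
    exact ⟨D i, rfl⟩
  have hσd : (Matrix.diagonal fun i => algebraMap ℂ K (σ i)) =
      algebraMap ℂ K (σ o) • Matrix.single o o (1 : K) := by
    ext r s
    by_cases hr : r = o
    · subst hr
      by_cases hs : r = s
      · subst hs; simp
      · simp [hs]
    · by_cases hs : r = s
      · subst hs; simp [hzero r hr, Ne.symm hr]
      · simp [hs, Matrix.single_apply_of_row_ne (Ne.symm hr)]
  have hσo := (hσ o).resolve_left ho
  refine ⟨⟨hf, h0, fun x => ⟨algebraMap ℂ K (σ o) * (g' * x * g) o o, ?_⟩, fun J w hw => ?_⟩,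
    ⟨σ o, hσo, ?_⟩, ?_⟩
  · rw [hpσ, hσd]
    have : Matrix.single o o (1 : K) * (g' * x * g) * Matrix.single o o (1 : K) =
        (g' * x * g) o o • Matrix.single o o (1 : K) := by
      rw [Matrix.single_mul_mul_single]
      simp
    simp only [mul_smul_comm, smul_mul_assoc]
    rw [show g * Matrix.single o o (1 : K) * g' * x * (g * Matrix.single o o 1 * g') =
      g * (Matrix.single o o (1 : K) * (g' * x * g) * Matrix.single o o 1) * g' by noncomm_ring,
      this, mul_smul_comm, smul_mul_assoc, smul_smul, smul_smul, smul_smul]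
    congr 1
    ring
  · obtain ⟨D, hD⟩ := hsurj fun t => if (t.2 : ℕ) = J then (g' * w * g) t.1.1 t.1.2 else 0
    have hDJ : ∀ k < J, matDer D (f k) = 0 := hvanish D J fun r s k hk hkJ => by
      rw [hD]
      exact if_neg hkJ.ne
    refine ⟨D, hDJ, ?_⟩
    have h1 := hlow D J hDJ
    rw [← hback (matDer D (f J)), ← hback w]
    congr 2
    ext r s
    by_cases hk : J ∈ R (r, s)
    · rw [← hΨ D r s J hk, hD]
      exact if_pos rfl
    · rw [hsupp J _ h1 r s hk, hsupp J w hw r s hk]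
  · rw [hpσ, hσd, ← algebraMap_smul K (σ o)]
    rw [show g * (algebraMap ℂ K (σ o) • Matrix.single o o (1 : K)) * g' *
      (g * (algebraMap ℂ K (σ o) • Matrix.single o o (1 : K)) * g') =
      g * ((algebraMap ℂ K (σ o) • Matrix.single o o (1 : K)) * (g' * g) *
        (algebraMap ℂ K (σ o) • Matrix.single o o (1 : K))) * g' by noncomm_ring, hg', mul_one]
    simp only [mul_smul_comm, smul_mul_assoc, Matrix.single_mul_single_same, mul_one]
  · obtain ⟨r, hr⟩ : ∃ r : Fin n, r ≠ o := by
      have : Nontrivial (Fin n) := Fin.nontrivial_iff_two_le.2 hn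
      exact exists_ne o
    have h1 := htwo (o, r) (by simp [hr])
    have h2 := htwo (r, o) (by simp [hr])
    have h3 : ∃ k : ℕ, 1 ≤ k ∧ (k : ℂ) = 3 + κ * σ o := exists_cast_eq_of_two_le_card h1.ge
      fun k hk => by
        have := (hR _ _).1 hk
        rw [← this, resEig, hzero r hr]
        rcases hσo with h | h <;> rw [h] <;> ring
    have h4 : ∃ k : ℕ, 1 ≤ k ∧ (k : ℂ) = 3 + -(κ * σ o) := exists_cast_eq_of_two_le_card
      h2.ge fun k hk => by
        have := (hR _ _).1 hk
        rw [← this, resEig, hzero r hr]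
        rcases hσo with h | h <;> rw [h] <;> ring
    rcases hσo with h | h <;> rw [h] at h3 h4
    · simpa [sub_eq_add_neg] using And.intro h3 h4
    · simpa [sub_eq_add_neg] using And.intro h4 h3

end Full

/-! ### Transposition and sign change -/

section Transposition

theorem conv_eq_coeff {A : Type*} [Ring A] (f g : ℕ → A) (k : ℕ) :
    conv f g k = PowerSeries.coeff k (PowerSeries.mk f * PowerSeries.mk g) := by
  simp [conv, PowerSeries.coeff_mul]

theorem conv_assoc {A : Type*} [Ring A] (f g h : ℕ → A) (k : ℕ) :
    conv (conv f g) h k = conv f (conv g h) k := by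
  have (f g : ℕ → A) : PowerSeries.mk (conv f g) = PowerSeries.mk f * PowerSeries.mk g := by
    ext k
    rw [PowerSeries.coeff_mk, conv_eq_coeff]
  rw [conv_eq_coeff, conv_eq_coeff, this, this, mul_assoc]

theorem transpose_conv {n : ℕ} {K : Type*} [CommRing K] (f g : ℕ → Matrix (Fin n) (Fin n) K) (k : ℕ) :
    (conv f g k).transpose = conv (fun i => (g i).transpose) (fun i => (f i).transpose) k := by
  rw [conv, conv, Matrix.transpose_sum, ← Finset.Nat.sum_antidiagonal_swap]
  exact sum_congr rfl fun x _ => Matrix.transpose_mul _ _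

variable {n : ℕ} {K : Type} [Field K] [Algebra ℂ K]

/-- Transposition reverses products: it changes the sign of the commutator and exchanges the left
and right coefficients. -/
theorem transpose_defect (κ : ℂ) (b c a : Matrix (Fin n) (Fin n) K)
    (f : ℕ → Matrix (Fin n) (Fin n) K) (k : ℕ) :
    (defect κ b c a f k).transpose =
      defect (-κ) c.transpose b.transpose a.transpose (fun i => (f i).transpose) k := by
  have h1 : (theta fun i => (f i).transpose) = fun i => (theta f i).transpose := by
    funext i
    simp only [theta, Matrix.transpose_smul]
  have h2 : conv (conv (fun i => (f i).transpose) fun i => (f i).transpose)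
      (fun i => (f i).transpose) k = (conv (conv f f) f k).transpose := by
    rw [conv_assoc, transpose_conv]
    congr 1
    funext i
    rw [transpose_conv]
  simp only [defect, h1, h2, Matrix.transpose_sub, Matrix.transpose_smul, transpose_conv,
    apply_ite Matrix.transpose, Matrix.transpose_add, Matrix.transpose_mul, Matrix.transpose_zero,
    neg_smul, ← smul_neg, neg_sub, add_comm (c.transpose * _)]

theorem transpose_resOp (κ : ℂ) (p : Matrix (Fin n) (Fin n) K) (k : ℕ)
    (w : Matrix (Fin n) (Fin n) K) :
    (resOp κ p k w).transpose = resOp (-κ) p.transpose k w.transpose := by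
  simp only [resOp, Matrix.transpose_sub, Matrix.transpose_smul, Matrix.transpose_add,
    Matrix.transpose_mul, mul_assoc]
  module

theorem IsFullSolution.transpose {κ : ℂ} {b c a : Mat n} {f : ℕ → Matrix (Fin n) (Fin n) K}
    (h : IsFullSolution κ b c a f) :
    IsFullSolution (-κ) c.transpose b.transpose a.transpose fun i => (f i).transpose where
  defect_eq_zero k := by
    have := congrArg Matrix.transpose (h.defect_eq_zero k)
    rw [transpose_defect] at this
    exact this
  ne_zero h0 := h.ne_zero (Matrix.transpose_eq_zero.1 h0)
  rank_one x := by
    obtain ⟨τ, hτ⟩ := h.rank_one x.transpose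
    refine ⟨τ, ?_⟩
    rw [← Matrix.transpose_smul, ← hτ]
    simp [mul_assoc]
  exists_derivation J w hw := by
    have hw' : resOp κ (f 0) J w.transpose = 0 := by
      rw [← Matrix.transpose_inj, transpose_resOp, Matrix.transpose_transpose, hw,
        Matrix.transpose_zero]
    obtain ⟨D, hD, hDJ⟩ := h.exists_derivation J _ hw'
    exact ⟨D, fun k hk => congrArg Matrix.transpose (hD k hk), congrArg Matrix.transpose hDJ⟩

theorem IsFullSolution.neg {κ : ℂ} {b c a : Mat n} {f : ℕ → Matrix (Fin n) (Fin n) K}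
    (h : IsFullSolution κ b c a f) : IsFullSolution (-κ) b c (-a) fun i => -f i where
  defect_eq_zero k := by rw [map_neg, defect_neg, h.defect_eq_zero, neg_zero]
  ne_zero := neg_ne_zero.2 h.ne_zero
  rank_one x := by
    obtain ⟨τ, hτ⟩ := h.rank_one x
    exact ⟨-τ, by rw [neg_smul_neg, ← hτ]; noncomm_ring⟩
  exists_derivation J w hw := by
    have hw' : resOp κ (f 0) J (-w) = 0 := by
      rw [← neg_eq_zero, ← hw]
      simp only [resOp, neg_mul, mul_neg, neg_neg]
      module
    obtain ⟨D, hD, hDJ⟩ := h.exists_derivation J _ hw'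
    exact ⟨D, fun k hk => by rw [map_neg, hD k hk, neg_zero], by rw [map_neg, hDJ, neg_neg]⟩

end Transposition

/-! ### Necessary conditions from differentiating the obstructions -/

section Obstructions

theorem eq_zero_or_eq_zero_of_forall_mul_mul {n : ℕ} {K : Type*} [Field K]
    {x y : Matrix (Fin n) (Fin n) K} (h : ∀ m, x * m * y = 0) : x = 0 ∨ y = 0 := by
  by_contra! hne
  obtain ⟨⟨r, i, hx⟩, j, s, hy⟩ : (∃ r i, x r i ≠ 0) ∧ ∃ j s, y j s ≠ 0 := by
    constructor
    · by_contra! h0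
      exact hne.1 (Matrix.ext h0)
    · by_contra! h0
      exact hne.2 (Matrix.ext h0)
  have := congrFun (congrFun (h (Matrix.single i j 1)) r) s
  rw [mul_assoc, Matrix.mul_apply, sum_eq_single i] at this
  · simp [hx, hy] at this
  · intro l _ hl
    rw [Matrix.single_mul_apply_of_ne _ _ _ _ _ hl, mul_zero]
  · simp

variable {n : ℕ} {K : Type} [Field K] [Algebra ℂ K] {κ : ℂ} {b c a : Mat n}
  {f : ℕ → Matrix (Fin n) (Fin n) K}

/-- These are tangent directions to the conjugacy class of the idempotent; they serve to vary the
residue itself. -/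
theorem resOp_zero_idem_compl {A : Type*} [Ring A] [Algebra ℂ A] {p : A} (hp : p * p = p) (κ : ℂ)
    (m : A) : resOp κ p 0 (p * m * (1 - p)) = 0 := by
  simp only [resOp, mul_sub, sub_mul, mul_one, mul_assoc, hp, mul_mul_of_mul_eq hp]
  push_cast
  module

theorem resOp_compl_compl {A : Type*} [Ring A] [Algebra ℂ A] {p : A} (hp : p * p = p) (κ : ℂ)
    {k : ℕ} (hk : k = 1 ∨ k = 2) (m : A) : resOp κ p k ((1 - p) * m * (1 - p)) = 0 := by
  have h1 : p * (1 - p) = 0 := by rw [mul_sub, hp, mul_one, sub_self]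
  have h2 : (1 - p) * p = 0 := by rw [sub_mul, hp, one_mul, sub_self]
  simp only [resOp, mul_assoc, h2, mul_mul_of_mul_eq h1, zero_mul,
    mul_zero]
  rcases hk with rfl | rfl <;> simp

theorem resOp_two_one_compl_idem {A : Type*} [Ring A] [Algebra ℂ A] {p : A} (hp : p * p = p)
    (m : A) : resOp 2 p 1 ((1 - p) * m * p) = 0 := by
  simp only [resOp, mul_sub, sub_mul, one_mul, mul_assoc, hp, mul_mul_of_mul_eq hp]
  push_cast
  module

/-- The residue has rank one and n ≥ 2, so 1 - p is nonzero and can be cancelled. -/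
theorem IsFullSolution.residue_ne_one (hn : 2 ≤ n) (h : IsFullSolution κ b c a f) :
    f 0 ≠ 1 := by
  intro h1
  let r : Fin n := ⟨0, by omega⟩
  let s : Fin n := ⟨1, by omega⟩
  have hrs : r ≠ s := by simp [r, s]
  obtain ⟨τ, hτ⟩ := h.rank_one (Matrix.single r s 1)
  rw [h1, one_mul, mul_one] at hτ
  have := congrFun (congrFun hτ r) s
  simp [hrs] at this

/-- A constant matrix with a vanishing block relative to the generic residue is scalar. -/
theorem IsFullSolution.exists_eq_smul_one (hn : 2 ≤ n) (h : IsFullSolution κ b c a f)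
    (hp : f 0 * f 0 = f 0) {d : Mat n}
    (hd : f 0 * (Algebra.ofId ℂ K).mapMatrix d * (1 - f 0) = 0) :
    ∃ t : ℂ, d = t • (1 : Mat n) := by
  set p := f 0 with hp0
  set δ := (Algebra.ofId ℂ K).mapMatrix d with hδ
  have : CharZero K := charZero_of_injective_algebraMap (algebraMap ℂ K).injective
  have hpq : p * (1 - p) = 0 := by rw [mul_sub, hp, mul_one, sub_self]
  have hqp : (1 - p) * p = 0 := by rw [sub_mul, hp, one_mul, sub_self]
  have hqq : (1 - p) * (1 - p) = 1 - p := by rw [sub_mul, hpq, one_mul, sub_zero]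
  have hq : ∀ D : Derivation ℂ K K, matDer D (1 - p) = -matDer D p := fun D => by
    have h1 : matDer D (1 : Matrix (Fin n) (Fin n) K) = 0 := by
      rw [← map_one (Algebra.ofId ℂ K).mapMatrix]
      exact matDer_map_algebraMap D 1
    rw [map_sub, h1, zero_sub]
  obtain ⟨τ, hτ⟩ := h.rank_one δ
  rw [← hp0] at hτ
  -- Differentiate `hd` along D p = p m (1 - p) and use p δ p = τ p; as m is arbitrary, the factor p
  -- m cancels.
  have h1 : (1 - p) * δ * (1 - p) = τ • (1 - p) := by
    have h2 : ∀ m, p * m * ((1 - p) * δ * (1 - p) - τ • (1 - p)) = 0 := by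
      intro m
      obtain ⟨D, -, hD⟩ := h.exists_derivation 0 _ (resOp_zero_idem_compl hp κ m)
      rw [← hp0] at hD
      have h3 := congrArg (matDer D) hd
      rw [matDer_mul, matDer_mul, hq, hD, hδ, matDer_map_algebraMap, map_zero, ← hδ, mul_zero,
        add_zero] at h3
      have h4 : p * δ * (p * m * (1 - p)) = τ • (p * m * (1 - p)) := by
        rw [← smul_mul_assoc, ← smul_mul_assoc, ← hτ]
        simp only [mul_assoc]
      rw [mul_neg, h4] at h3
      rw [← h3, mul_sub, mul_smul_comm]
      simp only [mul_assoc]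
      abel
    exact sub_eq_zero.1 ((eq_zero_or_eq_zero_of_forall_mul_mul h2).resolve_left h.ne_zero)
  have h2 : δ = τ • (1 : Matrix (Fin n) (Fin n) K) + (1 - p) * δ * p := by
    have : δ = p * δ * p + p * δ * (1 - p) + (1 - p) * δ * p + (1 - p) * δ * (1 - p) := by
      noncomm_ring
    rw [hd, hτ, h1] at this
    rw [this, add_zero]
    have h3 : (1 - p) * (τ • p + (1 - p) * δ * p + τ • (1 - p)) * p = (1 - p) * δ * p := by
      simp only [mul_add, add_mul, mul_smul_comm, smul_mul_assoc, ← mul_assoc, hqp, hqq]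
      simp [mul_assoc, hp]
    rw [h3, smul_sub]
    abel
  have hn0 : (n : ℂ) ≠ 0 := by
    rw [Nat.cast_ne_zero]; omega
  -- The remaining block is traceless, so τ = tr d / n is a constant and d - τ is a constant matrix.
  have h3 : τ = algebraMap ℂ K (d.trace / n) := by
    have h4 := congrArg Matrix.trace h2
    rw [Matrix.trace_add, Matrix.trace_mul_comm, ← mul_assoc, hpq, zero_mul, Matrix.trace_zero,
      add_zero, Matrix.trace_smul, Matrix.trace_one, Fintype.card_fin, smul_eq_mul] at h4
    have h5 : δ.trace = algebraMap ℂ K d.trace := by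
      simp only [Matrix.trace, map_sum]
      rfl
    rw [map_div₀, map_natCast, eq_div_iff (by rw [Nat.cast_ne_zero]; omega), ← h4, h5]
  refine ⟨d.trace / n, ?_⟩
  set t := d.trace / n
  let ω := (Algebra.ofId ℂ K).mapMatrix (d - t • (1 : Mat n))
  have hω : ω = (1 - p) * δ * p := by
    have : ω = δ - τ • (1 : Matrix (Fin n) (Fin n) K) := by
      simp only [ω, map_sub, map_smul, map_one, ← hδ, h3, algebraMap_smul]
    rw [this, sub_eq_iff_eq_add, add_comm]
    exact h2
  have hω1 : p * ω = 0 := by rw [hω, ← mul_assoc, ← mul_assoc, hpq, zero_mul, zero_mul]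
  -- Now p ω = 0 with ω constant; a second variation of p gives p m ω = 0, hence ω = 0.
  have h4 : ∀ m, p * m * ω = 0 := by
    intro m
    obtain ⟨D, -, hD⟩ := h.exists_derivation 0 _ (resOp_zero_idem_compl hp κ m)
    rw [← hp0] at hD
    have h5 := congrArg (matDer D) hω1
    rw [matDer_mul, hD, matDer_map_algebraMap, mul_zero, add_zero, map_zero, mul_assoc,
      sub_mul, hω1, one_mul, sub_zero] at h5
    exact h5
  have h5 := (eq_zero_or_eq_zero_of_forall_mul_mul h4).resolve_left h.ne_zero
  rw [← sub_eq_zero]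
  ext r s
  exact (algebraMap ℂ K).injective ((congrFun (congrFun h5 r) s).trans (map_zero _).symm)

theorem IsFullSolution.exists_eq_smul_one' (hn : 2 ≤ n) (h : IsFullSolution κ b c a f)
    (hp : f 0 * f 0 = f 0) {d : Mat n}
    (hd : (1 - f 0) * (Algebra.ofId ℂ K).mapMatrix d * f 0 = 0) :
    ∃ t : ℂ, d = t • (1 : Mat n) := by
  obtain ⟨t, ht⟩ := h.transpose.exists_eq_smul_one hn (d := d.transpose)
    (by rw [← Matrix.transpose_mul, hp]) (by
      have := congrArg Matrix.transpose hd
      rw [Matrix.transpose_mul, Matrix.transpose_mul, Matrix.transpose_sub, Matrix.transpose_one,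
        ← mul_assoc, Matrix.transpose_zero] at this
      exact this)
  exact ⟨t, by rw [← Matrix.transpose_inj, ht, Matrix.transpose_smul, Matrix.transpose_one]⟩

theorem compl_eq_zero_iff {A : Type*} [Ring A] {p : A} : 1 - p = 0 ↔ p = 1 := by
  rw [sub_eq_zero, eq_comm]

theorem IsFullSolution.kappa_zero (hn : 2 ≤ n) (h : IsFullSolution 0 b c a f)
    (hp : f 0 * f 0 = f 0) :
    (∃ t : ℂ, b - c = t • (1 : Mat n)) ∧ ∃ α : ℂ, a = α • (1 : Mat n) := by
  have h1 := kappa_zero_idem_defect_three_compl hp rfl (h.defect_eq_zero 1) (h.defect_eq_zero 2)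
  rw [h.defect_eq_zero, mul_zero, zero_mul, ← map_sub] at h1
  have hpf : f 0 * f 1 = 0 := idem_mul_coeff_one hp rfl (by norm_num) (h.defect_eq_zero 1)
  have h2 : ∃ t : ℂ, b - c = t • (1 : Mat n) := by
    refine h.exists_eq_smul_one hn hp ?_
    refine (eq_zero_or_eq_zero_of_forall_mul_mul (y := 1 - f 0) fun m => ?_).resolve_right
      (mt compl_eq_zero_iff.1 (h.residue_ne_one hn))
    -- Varying `f 1` on the kernel with p fixed isolates p (b - c) (1 - p).
    obtain ⟨D, hD0, hD⟩ := h.exists_derivation 1 _ (resOp_compl_compl hp 0 (Or.inl rfl) m)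
    have hDp := hD0 0 one_pos
    have h3 := congrArg (matDer D) h1
    have hD1 : matDer D (1 : Matrix (Fin n) (Fin n) K) = 0 := by
      rw [← map_one (Algebra.ofId ℂ K).mapMatrix]
      exact matDer_map_algebraMap D 1
    simp only [map_sub (matDer D), map_neg, matDer_mul, hDp, hD, matDer_map_algebraMap, map_zero,
      hD1, zero_mul, mul_zero, add_zero, zero_add, sub_zero] at h3
    rw [eq_comm, neg_eq_zero] at h3
    rw [← h3]
    simp only [mul_assoc]
  refine ⟨h2, h.exists_eq_smul_one hn hp ?_⟩
  obtain ⟨t, ht⟩ := h2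
  rw [ht, map_smul, map_one, mul_smul_comm, mul_one, smul_mul_assoc, hpf, smul_zero, neg_zero,
    zero_sub, eq_comm, neg_eq_zero] at h1
  exact h1

theorem IsFullSolution.kappa_one (hn : 2 ≤ n) (h : IsFullSolution 1 b c a f)
    (hp : f 0 * f 0 = f 0) :
    (∃ t : ℂ, b = t • (1 : Mat n)) ∧ ∃ t : ℂ, c = t • (1 : Mat n) := by
  have h1 := kappa_one_compl_defect_two_idem hp rfl (h.defect_eq_zero 1)
  rw [h.defect_eq_zero, mul_zero, zero_mul, eq_comm, neg_eq_zero] at h1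
  obtain ⟨t, ht⟩ := h.exists_eq_smul_one' hn hp h1
  refine ⟨⟨t, ht⟩, ?_⟩
  have h2 : ∀ k, defect 1 0 ((Algebra.ofId ℂ K).mapMatrix (c + t • (1 : Mat n)))
      ((Algebra.ofId ℂ K).mapMatrix a) f k = 0 := fun k => by
    rw [← defect_add_sub 1 t]
    refine Eq.trans ?_ (h.defect_eq_zero k)
    rw [ht]
    simp only [map_add, map_smul, map_one, zero_add, add_sub_cancel_right]
  have h3 := kappa_one_idem_defect_four_compl hp rfl (h2 1) (h2 2)
  rw [h2, mul_zero, zero_mul] at h3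
  obtain ⟨s, hs⟩ : ∃ s : ℂ, c + t • (1 : Mat n) = s • (1 : Mat n) := by
    refine h.exists_eq_smul_one hn hp ?_
    refine (eq_zero_or_eq_zero_of_forall_mul_mul (y := 1 - f 0) fun m => ?_).resolve_right
      (mt compl_eq_zero_iff.1 (h.residue_ne_one hn))
    -- Varying `f 2` on the kernel, with p and `f 1` fixed, removes the constant term of the
    -- condition at k = 4.
    obtain ⟨D, hD0, hD⟩ := h.exists_derivation 2 _ (resOp_compl_compl hp 1 (Or.inr rfl) m)
    have hDp := hD0 0 two_pos
    have hDf := hD0 1 one_lt_two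
    have h4 := congrArg (matDer D) h3
    have hD1 : matDer D (1 : Matrix (Fin n) (Fin n) K) = 0 := by
      rw [← map_one (Algebra.ofId ℂ K).mapMatrix]
      exact matDer_map_algebraMap D 1
    simp only [map_sub (matDer D), map_add (matDer D), map_smul (matDer D), matDer_mul, hDp, hDf,
      hD, matDer_map_algebraMap, map_zero, smul_zero,
      hD1, zero_mul, mul_zero, add_zero, zero_add, sub_zero, mul_smul_comm, smul_mul_assoc] at h4
    rw [eq_comm, smul_eq_zero, or_iff_right (by norm_num)] at h4
    have hqq : (1 - f 0) * (1 - f 0) = 1 - f 0 := by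
      rw [sub_mul, mul_sub, mul_sub, hp, one_mul, mul_one, sub_self, sub_zero, one_mul]
    simp only [mul_assoc, hqq, mul_mul_of_mul_eq hqq] at h4 ⊢
    exact h4
  exact ⟨s - t, by rw [sub_smul, ← hs]; abel⟩

theorem IsFullSolution.kappa_two (hn : 2 ≤ n) (h : IsFullSolution 2 b c a f)
    (hp : f 0 * f 0 = f 0) :
    (∃ t : ℂ, b - c = t • (1 : Mat n)) ∧ ∃ s : ℂ, b * a - a * b - (2 : ℂ) • b = s • (1 : Mat n) := by
  have hq1 := mt compl_eq_zero_iff.1 (h.residue_ne_one hn)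
  have hpf : f 0 * f 1 = 0 := kappa_two_coeff_one hp rfl (h.defect_eq_zero 1)
  have h1 := kappa_two_idem_defect_four_idem hp rfl (h.defect_eq_zero 1) (h.defect_eq_zero 2)
  rw [h.defect_eq_zero, mul_zero, zero_mul] at h1
  have hD1 (D : Derivation ℂ K K) : matDer D (1 : Matrix (Fin n) (Fin n) K) = 0 := by
    rw [← map_one (Algebra.ofId ℂ K).mapMatrix]
    exact matDer_map_algebraMap D 1
  have h2 : f 0 * (Algebra.ofId ℂ K).mapMatrix (b - c) * f 1 * (1 - f 0) = 0 := by
    refine (eq_zero_or_eq_zero_of_forall_mul_mul (y := f 0) fun m => ?_).resolve_right h.ne_zero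
    -- The condition at k = 4 is quadratic in `f 1`. A variation of its lower block leaves a
    -- condition linear in `f 1`; a variation on the kernel then removes `f 1` altogether.
    obtain ⟨D, hD0, hD⟩ := h.exists_derivation 1 _ (resOp_two_one_compl_idem hp m)
    have hDp := hD0 0 one_pos
    have h3 := congrArg (matDer D) h1
    simp only [map_sub (matDer D), map_add (matDer D), map_smul (matDer D), map_neg, matDer_mul,
      hDp, hD, matDer_map_algebraMap, map_zero, hD1, zero_mul, mul_zero, add_zero, zero_add,
      sub_zero, smul_zero] at h3
    rw [eq_comm, neg_eq_zero, ← map_sub] at h3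
    simp only [mul_assoc, hp, add_mul, mul_mul_of_mul_eq hpf, zero_mul, mul_zero,
      zero_add] at h3 ⊢
    exact h3
  obtain ⟨t, ht⟩ : ∃ t : ℂ, b - c = t • (1 : Mat n) := by
    refine h.exists_eq_smul_one hn hp ?_
    refine (eq_zero_or_eq_zero_of_forall_mul_mul (y := 1 - f 0) fun m => ?_).resolve_right hq1
    obtain ⟨D, hD0, hD⟩ := h.exists_derivation 1 _ (resOp_compl_compl hp 2 (Or.inl rfl) m)
    have hDp := hD0 0 one_pos
    have h3 := congrArg (matDer D) h2
    simp only [map_sub (matDer D), matDer_mul, hDp, hD, matDer_map_algebraMap, map_zero, hD1,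
      zero_mul, mul_zero, add_zero, zero_add, sub_zero] at h3
    have hqq : (1 - f 0) * (1 - f 0) = 1 - f 0 := by
      rw [sub_mul, mul_sub, mul_sub, hp, one_mul, mul_one, sub_self, sub_zero, one_mul]
    simp only [mul_assoc, hqq] at h3 ⊢
    exact h3
  refine ⟨⟨t, ht⟩, ?_⟩
  -- Half of the scalar b - c is moved from b to c, so that the two become equal and the condition
  -- at k = 5 applies.
  have h3 : ∀ k, defect 2 ((Algebra.ofId ℂ K).mapMatrix (b - (t / 2) • (1 : Mat n)))
      ((Algebra.ofId ℂ K).mapMatrix (b - (t / 2) • (1 : Mat n)))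
      ((Algebra.ofId ℂ K).mapMatrix a) f k = 0 := fun k => by
    rw [← h.defect_eq_zero k, ← defect_add_sub 2 (t / 2)]
    have hc : c = b - (t / 2) • (1 : Mat n) - (t / 2) • (1 : Mat n) := by
      rw [sub_sub, ← add_smul, add_halves, ← ht, sub_sub_cancel]
    rw [hc]
    simp only [map_sub, map_smul, map_one, sub_add_cancel]
  have h4 := kappa_two_five hp rfl (h3 1) (h3 2) (h3 3) (h3 4)
  rw [h3, mul_zero, zero_mul, eq_comm, smul_eq_zero, or_iff_right (by norm_num), ← map_mul,
    ← map_mul, ← map_smul, ← map_sub, ← map_sub] at h4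
  obtain ⟨s, hs⟩ := h.exists_eq_smul_one hn hp h4
  refine ⟨s - t, ?_⟩
  simp only [sub_mul, mul_sub, smul_mul_assoc, mul_smul_comm, one_mul, mul_one] at hs
  linear_combination (norm := module) hs

end Obstructions

/-! ### Assembly of necessity and normalization -/

/-- The conditions imposed by the test on the coefficients, before normalization. -/
def IsNormalizable {n : ℕ} (κ : ℂ) (b c a : Mat n) : Prop :=
  (κ = 0 ∧ (∃ t : ℂ, b - c = t • (1 : Mat n)) ∧ ∃ α : ℂ, a = α • (1 : Mat n)) ∨
  ((κ = 1 ∨ κ = -1) ∧ (∃ t : ℂ, b = t • (1 : Mat n)) ∧ ∃ t : ℂ, c = t • (1 : Mat n)) ∨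
  ((κ = 2 ∨ κ = -2) ∧ (∃ t : ℂ, b - c = t • (1 : Mat n)) ∧
    ∃ s : ℂ, b * a - a * b - κ • b = s • (1 : Mat n))

theorem IsNormalizable.neg {n : ℕ} {κ : ℂ} {b c a : Mat n} (h : IsNormalizable κ b c a) :
    IsNormalizable (-κ) b c (-a) := by
  rcases h with ⟨rfl, hb, α, rfl⟩ | ⟨hκ, hb, hc⟩ | ⟨hκ, hb, s, hs⟩
  · exact Or.inl ⟨neg_zero, hb, -α, (neg_smul _ _).symm⟩
  · exact Or.inr (Or.inl ⟨by rcases hκ with rfl | rfl <;> simp, hb, hc⟩)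
  · refine Or.inr (Or.inr ⟨by rcases hκ with rfl | rfl <;> simp, hb, -s, ?_⟩)
    rw [neg_smul, neg_smul, ← hs]
    noncomm_ring

theorem IsNormalizable.transpose {n : ℕ} {κ : ℂ} {b c a : Mat n} (h : IsNormalizable κ b c a) :
    IsNormalizable (-κ) c.transpose b.transpose a.transpose := by
  have hsub (hb : ∃ t : ℂ, b - c = t • (1 : Mat n)) :
      ∃ t : ℂ, c.transpose - b.transpose = t • (1 : Mat n) := by
    obtain ⟨t, ht⟩ := hb
    refine ⟨-t, ?_⟩
    rw [← Matrix.transpose_sub, ← neg_sub, ht, ← neg_smul, Matrix.transpose_smul,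
      Matrix.transpose_one]
  rcases h with ⟨rfl, hb, α, rfl⟩ | ⟨hκ, ⟨t, rfl⟩, s, rfl⟩ | ⟨hκ, hb, s, hs⟩
  · exact Or.inl ⟨neg_zero, hsub hb, α, by simp⟩
  · exact Or.inr (Or.inl ⟨by rcases hκ with rfl | rfl <;> simp, ⟨s, by simp⟩, t, by simp⟩)
  · refine Or.inr (Or.inr ⟨by rcases hκ with rfl | rfl <;> simp, hsub hb, ?_⟩)
    obtain ⟨t, ht⟩ := hb
    obtain rfl : c = b - t • (1 : Mat n) := by rw [← ht, sub_sub_cancel]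
    refine ⟨-s - κ * t, ?_⟩
    rw [← Matrix.transpose_inj]
    simp only [Matrix.transpose_sub, Matrix.transpose_mul, Matrix.transpose_smul,
      Matrix.transpose_transpose, Matrix.transpose_one, mul_sub, sub_mul, mul_smul_comm,
      smul_mul_assoc, one_mul, mul_one]
    linear_combination (norm := module) -hs

/-- The two positive integers 3 + κ and 3 - κ add up to 6, which leaves five cases. -/
theorem natCast_eq_of_add_sub {κ : ℂ} (h1 : ∃ k : ℕ, 1 ≤ k ∧ (k : ℂ) = 3 + κ)
    (h2 : ∃ k : ℕ, 1 ≤ k ∧ (k : ℂ) = 3 - κ) : κ = 0 ∨ κ = 1 ∨ κ = 2 ∨ κ = -1 ∨ κ = -2 := by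
  obtain ⟨i, hi, hi'⟩ := h1
  obtain ⟨j, hj, hj'⟩ := h2
  have hij : i + j = 6 := by exact_mod_cast (by linear_combination hi' + hj' : (i : ℂ) + j = 6)
  have hκ : κ = i - 3 := by linear_combination -hi'
  have : i = 1 ∨ i = 2 ∨ i = 3 ∨ i = 4 ∨ i = 5 := by omega
  rcases this with rfl | rfl | rfl | rfl | rfl <;> norm_num [hκ]

theorem IsFullSolution.isNormalizable {n : ℕ} (hn : 2 ≤ n) {K : Type} [Field K] [Algebra ℂ K]
    {κ : ℂ} {b c a : Mat n} {f : ℕ → Matrix (Fin n) (Fin n) K} (h : IsFullSolution κ b c a f)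
    (hp : f 0 * f 0 = f 0) (hκ : κ = 0 ∨ κ = 1 ∨ κ = 2 ∨ κ = -1 ∨ κ = -2) :
    IsNormalizable κ b c a := by
  have hpos {κ : ℂ} {b c a : Mat n} {f : ℕ → Matrix (Fin n) (Fin n) K}
      (h : IsFullSolution κ b c a f) (hp : f 0 * f 0 = f 0) (hκ : κ = 0 ∨ κ = 1 ∨ κ = 2) :
      IsNormalizable κ b c a := by
    rcases hκ with rfl | rfl | rfl
    · exact Or.inl ⟨rfl, h.kappa_zero hn hp⟩
    · exact Or.inr (Or.inl ⟨Or.inl rfl, h.kappa_one hn hp⟩)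
    · exact Or.inr (Or.inr ⟨Or.inl rfl, h.kappa_two hn hp⟩)
  by_cases hκ' : κ = 0 ∨ κ = 1 ∨ κ = 2
  · exact hpos h hp hκ'
  · have := (hpos h.transpose (by rw [← Matrix.transpose_mul, hp]) (by
      rcases hκ with rfl | rfl | rfl | rfl | rfl <;> simp at hκ' ⊢)).transpose
    simpa using this

theorem isNormalizable_of_passesTest {n : ℕ} (hn : 2 ≤ n) {κ : ℂ} {b c a : Mat n}
    (h : PassesTest κ b c a) : IsNormalizable κ b c a := by
  obtain ⟨K, _, _, f, u, hu, huf, h0, hf⟩ := exists_generic_solution (h 0)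
  obtain ⟨hfull, ⟨ε, rfl | rfl, hp⟩, h1, h2⟩ :=
    IsFullSolution.of_algebraicIndependent hn hf h0 hu huf
  · rw [one_smul] at hp
    exact hfull.isNormalizable hn hp (natCast_eq_of_add_sub h1 h2)
  -- For eigenvalue -1 the solution -y has idempotent residue and satisfies the equation with -κ and
  -- -a.
  · rw [neg_smul, one_smul] at hp
    have := (hfull.neg.isNormalizable hn (by rw [neg_mul_neg, hp])
      (natCast_eq_of_add_sub (by simpa [sub_eq_add_neg] using h2) (by simpa using h1))).neg
    simpa using this

theorem normalForm_of_isNormalizable {n : ℕ} {κ : ℂ} {b₁ b₂ a : Mat n}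
    (h : IsNormalizable κ b₁ b₂ a) : ∃ β₁ β₂ : ℂ, IsP20 (shiftedRhs κ b₁ b₂ a β₁ β₂) ∨
      IsP21 (shiftedRhs κ b₁ b₂ a β₁ β₂) ∨ IsP22 (shiftedRhs κ b₁ b₂ a β₁ β₂) := by
  rcases h with ⟨rfl, ⟨t, ht⟩, α, rfl⟩ | ⟨hκ, ⟨t, rfl⟩, s, rfl⟩ | ⟨hκ, ⟨t, ht⟩, s, hs⟩
  · refine ⟨-t, 0, Or.inl ⟨α, b₂, fun z y w => ?_⟩⟩
    obtain rfl : b₁ = t • (1 : Mat n) + b₂ := sub_eq_iff_eq_add.1 ht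
    simp only [shiftedRhs, rhs, smul_mul_assoc, one_mul, add_mul, mul_add, mul_smul_comm, mul_one]
    module
  · refine ⟨-t, -s, Or.inr (Or.inl ⟨κ, a, hκ, fun z y w => ?_⟩)⟩
    simp only [shiftedRhs, rhs, smul_mul_assoc, one_mul, add_mul, mul_add, mul_smul_comm, mul_one]
    module
  · have hκ0 : κ ≠ 0 := by rcases hκ with rfl | rfl <;> norm_num
    -- Adding s / κ to b₁ leaves [b, a] unchanged and raises κ b by s, which cancels the scalar
    -- defect; the extra t makes both sides of y carry the same b.
    refine ⟨s / κ, s / κ + t, Or.inr (Or.inr ⟨κ / 2, a, b₁ + (s / κ) • (1 : Mat n), ?_, ?_,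
      fun z y w => ?_⟩)⟩
    · rcases hκ with rfl | rfl <;> norm_num
    · have hs' : κ • ((s / κ) • (1 : Mat n)) = s • (1 : Mat n) := by
        rw [smul_smul, mul_div_cancel₀ _ hκ0]
      rw [div_mul_cancel₀ _ (two_ne_zero), smul_add, hs']
      simp only [add_mul, mul_add, smul_mul_assoc, mul_smul_comm, one_mul, mul_one]
      linear_combination (norm := module) hs
    · obtain rfl : b₂ = b₁ - t • (1 : Mat n) := by rw [← ht, sub_sub_cancel]
      simp only [shiftedRhs, rhs, smul_mul_assoc, one_mul, add_mul, mul_add, mul_smul_comm, mul_one,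
        mul_sub]
      rw [div_mul_cancel₀ _ (two_ne_zero)]
      module

/-- For n = 1 everything commutes and b₁, b₂ are scalars, so the shift removes them and no condition
remains. -/
theorem isP20_of_subsingleton {n : ℕ} [Subsingleton (Fin n)] (o : Fin n) (κ : ℂ)
    (b₁ b₂ a : Mat n) : IsP20 (shiftedRhs κ b₁ b₂ a (-b₁ o o) (-b₂ o o)) := by
  have hs (x : Mat n) : x = x o o • (1 : Mat n) := by
    ext r s
    obtain rfl := Subsingleton.elim r o
    obtain rfl := Subsingleton.elim s r
    simp
  refine ⟨a o o, 0, fun z y w => ?_⟩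
  have hc : y * w = w * y := by
    rw [hs w, mul_smul_comm, smul_mul_assoc, one_mul, mul_one]
  have h1 : b₁ + -b₁ o o • (1 : Mat n) = 0 := by
    rw [neg_smul, ← hs b₁, add_neg_cancel]
  have h2 : b₂ + -b₂ o o • (1 : Mat n) = 0 := by
    rw [neg_smul, ← hs b₂, add_neg_cancel]
  simp only [shiftedRhs, rhs, h1, h2, hc, ← hs a]
  simp

end MatrixPainleveTwo

theorem theorem1 (n : ℕ) (hn : 1 ≤ n) (κ : ℂ)
    (b₁ b₂ a : Matrix (Fin n) (Fin n) ℂ) :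
    MatrixPainleveTwo.PassesTest κ b₁ b₂ a ↔
      ∃ β₁ β₂ : ℂ,
        MatrixPainleveTwo.IsP20 (MatrixPainleveTwo.shiftedRhs κ b₁ b₂ a β₁ β₂) ∨
        MatrixPainleveTwo.IsP21 (MatrixPainleveTwo.shiftedRhs κ b₁ b₂ a β₁ β₂) ∨
        MatrixPainleveTwo.IsP22 (MatrixPainleveTwo.shiftedRhs κ b₁ b₂ a β₁ β₂) := by
  refine ⟨fun h => ?_, fun ⟨β₁, β₂, h⟩ => MatrixPainleveTwo.passesTest_of_normalForm hn h⟩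
  rcases hn.eq_or_lt with rfl | hn
  · exact ⟨_, _, Or.inl (MatrixPainleveTwo.isP20_of_subsingleton 0 κ b₁ b₂ a)⟩
  · exact MatrixPainleveTwo.normalForm_of_isNormalizable
      (MatrixPainleveTwo.isNormalizable_of_passesTest hn h)
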